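/- Let $N\ge 1$ and $T_1,T_2\ge 0$ be integers. In double blind $T$-private information retrieval (DB-TPIR) with parameters $(q,L,N,K_1,K_2,T_1,T_2)$, where $q$ is a prime power and $L\ge 1$, each of $N$ servers stores the whole database $W=(W(k_1,k_2))_{1\le k_1\le K_1,\,1\le k_2\le K_2}$ of independent messages, each uniform on $\mathbb F_q^L$. User $m\in\{1,2\}$ has an index $\theta_m$, uniform on $\{1,\dots,K_m\}$, and private discrete randomness $\mathcal Z_m$; the servers share discrete randomness $\widetilde{\mathcal Z}$ that is unknown to the users; $W,\widetilde{\mathcal Z},\theta_1,\theta_2,\mathcal Z_1,\mathcal Z_2$ are independent. User $m$ sends to each server $n$ a query $Q_n^{(m)}$ that is a function of $(\theta_m,\mathcal Z_m)$, and server $n$ returns to both users an answer $A_n$, a string over $\mathbb F_q$ that is a function of $(W,Q_n^{(1)},Q_n^{(2)},\widetilde{\mathcal Z})$; the possible answers of each server form a prefix code (for instance, they all have the same length). A DB-TPIR scheme has to satisfy, for $m\in\{1,2\}$ and $m'=3-m$: - ($T_m$-privacy) $I\big(\theta_m;\,(Q_n^{(1)},Q_n^{(2)})_{n\in\mathcal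 T}\,\big|\,W,\widetilde{\mathcal Z}\big)=0$ for every $\mathcal T\subset\{1,\dots,N\}$ with $|\mathcal T|\le T_m$; - (inter-user privacy) $I\big(\theta_{m'};\,A_1,\dots,A_N\,\big|\,\theta_m,\mathcal Z_m,W(\theta_1,\theta_2)\big)=0$; - (correctness) $H\big(W(\theta_1,\theta_2)\,\big|\,A_1,\dots,A_N,\theta_m,\mathcal Z_m\big)=0$. Its rate is $L/D$, where $D$ is the maximum, over all realizations, of the total number of $q$-ary symbols in $A_1,\dots,A_N$. Let $R^*(q,L,N,K_1,K_2,T_1,T_2)$ be the supremum of the rates of all DB-TPIR schemes with these parameters ($0$ if there are none). Theorem. For every prime power $q$ and every $L\ge1$ the double limit $\lim_{K_1,K_2\to\infty}R^*(q,L,N,K_1,K_2,T_1,T_2)$ exists, and the asymptotic capacity of DB-TPIR under the bounded-latency constraint is $$C^{\infty,\mathrm{b.l.}}(N,T_1,T_2):=\sup_{q,L}\ \lim_{K_1,K_2\to\infty}R^*(q,L,N,K_1,K_2,T_1,T_2)=\Big(1-\frac{T_1+T_2}{N}\Big)^+,$$ where the supremum is over all prime powers $q$ and all $L\ge 1$,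 and $(x)^+=\max(x,0)$. -/

import Mathlib

open MeasureTheory ProbabilityTheory Filter Topology
open scoped ENNReal

noncomputable section

namespace DBTPIR

/-! ### Information measures of discrete random variables (natural logarithms) -/

section Information

variable {Ω : Type*} [MeasurableSpace Ω]

/-- Shannon entropy `H(X)` of a discrete random variable. -/
def entropy {α : Type*} (μ : Measure Ω) (X : Ω → α) : ℝ≥0∞ :=
  ∑' x, ENNReal.ofReal (Real.negMulLog (μ.real (X ⁻¹' {x})))

/-- Conditional entropy `H(X | Y) = ∑ y, P(Y = y) H(X | Y = y)`. -/
def condEntropy {α β : Type*} (μ : Measure Ω) (X : Ω → α) (Y : Ω → β) : ℝ≥0∞ :=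
  ∑' y, μ (Y ⁻¹' {y}) * entropy (μ[|Y ⁻¹' {y}]) X

/-- Mutual information `I(X; Y)`: the Kullback-Leibler divergence of the joint law from the product
of the marginal laws. The (countable) alphabets are discrete. -/
def mutualInfo {α β : Type*} [Countable α] [Countable β]
    (μ : Measure Ω) (X : Ω → α) (Y : Ω → β) : ℝ≥0∞ :=
  letI : MeasurableSpace α := ⊤
  letI : MeasurableSpace β := ⊤
  InformationTheory.klDiv (μ.map fun ω => (X ω, Y ω)) ((μ.map X).prod (μ.map Y))

/-- Conditional mutual information `I(X; Y | Z) = ∑ z, P(Z = z) I(X; Y | Z = z)`. -/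
def condMutualInfo {α β γ : Type*} [Countable α] [Countable β]
    (μ : Measure Ω) (X : Ω → α) (Y : Ω → β) (Z : Ω → γ) : ℝ≥0∞ :=
  ∑' z, μ (Z ⁻¹' {z}) * mutualInfo (μ[|Z ⁻¹' {z}]) X Y

end Information

/-! ### Double blind `T`-private information retrieval -/

/-- A discrete source of randomness. -/
structure RandomSource where
  Value : Type
  [countable : Countable Value]
  [measurableSpace : MeasurableSpace Value]
  [discrete : DiscreteMeasurableSpace Value]
  law : Measure Value
  [isProbabilityMeasure : IsProbabilityMeasure law]

attribute [instance] RandomSource.countable RandomSource.measurableSpace RandomSource.discrete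
  RandomSource.isProbabilityMeasure

/-- A message: `L` symbols of the alphabet `F`. -/
abbrev Message (F : Type) (L : ℕ) : Type := Fin L → F

/-- A database: one message for every pair of indices. -/
def Database (F : Type) (L K₁ K₂ : ℕ) : Type := Fin K₁ → Fin K₂ → Message F L

instance (F : Type) (L K₁ K₂ : ℕ) : MeasurableSpace (Database F L K₁ K₂) := ⊤

/-- The data of a retrieval protocol with `N` servers, all of them storing the whole database, and
two users: private randomness of the users, common randomness of the servers, the queries that a
user sends to the servers (a function of its index and its randomness), and the answer that a
server returns to both users, a string over `F` (a function of the database, the two queries it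
received, and the common randomness). -/
structure Scheme (F : Type) (L N K₁ K₂ : ℕ) where
  user₁ : RandomSource
  user₂ : RandomSource
  server : RandomSource
  Query₁ : Type
  Query₂ : Type
  [countable₁ : Countable Query₁]
  [countable₂ : Countable Query₂]
  query₁ : Fin K₁ → user₁.Value → Fin N → Query₁
  query₂ : Fin K₂ → user₂.Value → Fin N → Query₂
  answer : Fin N → Database F L K₁ K₂ → Query₁ → Query₂ → server.Value → List F

attribute [instance] Scheme.countable₁ Scheme.countable₂

namespace Scheme

variable {F : Type} {L N K₁ K₂ : ℕ} (S : Scheme F L N K₁ K₂)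

/-- A joint realization of the database, the common randomness of the servers, and the index and
the private randomness of each user. -/
abbrev Sample : Type :=
  Database F L K₁ K₂ × S.server.Value × (Fin K₁ × S.user₁.Value) × (Fin K₂ × S.user₂.Value)

/-- The joint law: all components are independent, the database (hence every symbol of every
message) and the two indices are uniform. -/
def law : Measure S.Sample :=
  (uniformOn Set.univ).prod (S.server.law.prod
    (((uniformOn Set.univ).prod S.user₁.law).prod ((uniformOn Set.univ).prod S.user₂.law)))

/-- The database `W`. -/
def W (ω : S.Sample) : Database F L K₁ K₂ := ω.1

/-- The common randomness of the servers. -/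
def Zs (ω : S.Sample) : S.server.Value := ω.2.1

/-- The index of user 1. -/
def θ₁ (ω : S.Sample) : Fin K₁ := ω.2.2.1.1

/-- The private randomness of user 1. -/
def Z₁ (ω : S.Sample) : S.user₁.Value := ω.2.2.1.2

/-- The index of user 2. -/
def θ₂ (ω : S.Sample) : Fin K₂ := ω.2.2.2.1

/-- The private randomness of user 2. -/
def Z₂ (ω : S.Sample) : S.user₂.Value := ω.2.2.2.2

/-- The desired message `W(θ₁, θ₂)`. -/
def desired (ω : S.Sample) : Message F L := S.W ω (S.θ₁ ω) (S.θ₂ ω)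

/-- The pair of queries received by server `n`. -/
def Q (ω : S.Sample) (n : Fin N) : S.Query₁ × S.Query₂ :=
  (S.query₁ (S.θ₁ ω) (S.Z₁ ω) n, S.query₂ (S.θ₂ ω) (S.Z₂ ω) n)

/-- The answer of server `n`. -/
def A (ω : S.Sample) (n : Fin N) : List F :=
  S.answer n (S.W ω) (S.Q ω n).1 (S.Q ω n).2 (S.Zs ω)

/-- The conditions that make a protocol a double blind `(T₁, T₂)`-private one. -/
structure IsDBTPIR [Finite F] (T₁ T₂ : ℕ) : Prop where
  /-- The possible answers of each server form a prefix code, so that a user can tell from the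
  received symbols alone where an answer ends (automatic if the answers of a server all have the
  same length). -/
  prefixFree : ∀ (n : Fin N) (ω ω' : S.Sample), S.law {ω} ≠ 0 → S.law {ω'} ≠ 0 →
    S.A ω n <+: S.A ω' n → S.A ω n = S.A ω' n
  /-- Privacy of the index of user 1 from any `T₁` colluding servers. -/
  private₁ : ∀ 𝒯 : Finset (Fin N), 𝒯.card ≤ T₁ →
    condMutualInfo S.law S.θ₁ (fun ω (n : 𝒯) => S.Q ω n) (fun ω => (S.W ω, S.Zs ω)) = 0
  /-- Privacy of the index of user 2 from any `T₂` colluding servers. -/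
  private₂ : ∀ 𝒯 : Finset (Fin N), 𝒯.card ≤ T₂ →
    condMutualInfo S.law S.θ₂ (fun ω (n : 𝒯) => S.Q ω n) (fun ω => (S.W ω, S.Zs ω)) = 0
  /-- Privacy of the index of user 2 from user 1. -/
  interUser₁ : condMutualInfo S.law S.θ₂ S.A (fun ω => (S.θ₁ ω, S.Z₁ ω, S.desired ω)) = 0
  /-- Privacy of the index of user 1 from user 2. -/
  interUser₂ : condMutualInfo S.law S.θ₁ S.A (fun ω => (S.θ₂ ω, S.Z₂ ω, S.desired ω)) = 0
  /-- User 1 recovers the desired message. -/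
  correct₁ : condEntropy S.law S.desired (fun ω => (S.A ω, S.θ₁ ω, S.Z₁ ω)) = 0
  /-- User 2 recovers the desired message. -/
  correct₂ : condEntropy S.law S.desired (fun ω => (S.A ω, S.θ₂ ω, S.Z₂ ω)) = 0

/-- The download `D`: the maximum, over all realizations (of positive probability), of the total
number of symbols of `F` that the servers return. -/
def download : ℕ∞ :=
  ⨆ (ω : S.Sample) (_ : S.law {ω} ≠ 0), ((∑ n, (S.A ω n).length : ℕ) : ℕ∞)

/-- The rate `L / D`. -/
def rate : ℝ≥0∞ := (L : ℝ≥0∞) / (S.download : ℝ≥0∞)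

end Scheme

/-- The supremum `R*(q, L, N, K₁, K₂, T₁, T₂)` of the rates of all DB-TPIR schemes with these
parameters, where `q = |F|` (the supremum is `0` if there is no such scheme). -/
def optimalRate (F : Type) [Finite F] (L N K₁ K₂ T₁ T₂ : ℕ) : ℝ≥0∞ :=
  ⨆ (S : Scheme F L N K₁ K₂) (_ : S.IsDBTPIR T₁ T₂), S.rate

/-- `r` is the double limit of `R*(q, L, N, K₁, K₂, T₁, T₂)` as `K₁, K₂ → ∞`, where `q = |F|`. -/
def IsLimitRate (F : Type) [Finite F] (L N T₁ T₂ : ℕ) (r : ℝ≥0∞) : Prop :=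
  Tendsto (fun K : ℕ × ℕ => optimalRate F L N K.1 K.2 T₁ T₂) atTop (𝓝 r)

/-- The asymptotic capacity under the bounded-latency constraint: the supremum over the finite
fields `F` and the message lengths `L ≥ 1` of the limit of the optimal rate as `K₁, K₂ → ∞`. -/
def asymptoticCapacity (N T₁ T₂ : ℕ) : ℝ≥0∞ :=
  sSup {r | ∃ (F : Type) (_ : Field F) (_ : Finite F) (L : ℕ), 0 < L ∧ IsLimitRate F L N T₁ T₂ r}

end DBTPIR

end

noncomputable section

namespace DBTPIR

/-! ### Vanishing of information measures as statements about point masses -/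

section Information

variable {Ω : Type*} [MeasurableSpace Ω]

/-! Existence of the limit. A scheme for a large database also serves a smaller nonempty one: the
servers invent the missing messages with their common randomness (`Scheme.restrict`). Hence `R*` is
antitone in positive `K₁, K₂` and tends to its infimum.

Converse. Privacy makes the law of user 1's queries to `T₁` servers independent of the index. So one
can choose, for each index `i`, a realization `ζ₁ i` of user 1's randomness such that the queries to
a set `𝒯₁` of at most `T₁` servers are the same for all `i`, and likewise `ζ₂ j` for user 2 and a
set `𝒯₂`. With the servers' randomness fixed as well, run the protocol for all `K₁ * K₂` index
pairs. The answers from `𝒯₁` depend on `j` only, those from `𝒯₂` on `i` only, and only the remaining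
`N - (T₁ + T₂)` servers `R` answer afresh for each pair. By correctness these answers determine the
whole database, that is `K₁ * K₂ * L` symbols. If `R` consists of the servers with the least mean
download, and the realizations are chosen so that the total length from `R` is at most its mean,
source coding for prefix codes gives `K₁ K₂ L ≤ (K₁ + K₂) D + K₁ K₂ D (N - T₁ - T₂)⁺ / N`. The term
with `K₁ + K₂` disappears in the limit. The steps are `exists_selection`, `mul_card_le_sum_length`,
`mul_card_le_of_realization` and `mul_le_download_mul`.

Achievability, by cross-subspace alignment with `L = N - T₁ - T₂` over a field with at least `N + L`
elements. Each user secret-shares the indicator vector of its index by polynomials in the server's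
point. For symbol `l`, the bilinear form of the database in the two shares is a polynomial `G` of
degree at most `T₁ + T₂` whose value at `β l` is the desired symbol. Dividing by `β l - α n` splits
it into a Cauchy term carrying that symbol and a polynomial of degree less than `T₁ + T₂`
(`exists_degree_lt_eval`). All interference therefore lies in one space of dimension `T₁ + T₂`,
where the servers' uniform polynomial masks it, which gives inter-user privacy. The
Cauchy-Vandermonde system is nonsingular, which gives correctness. One symbol per server is
downloaded, so the rate is at least `L / N`. -/

theorem measure_ne_zero_iff_exists [Countable Ω] (μ : Measure Ω) (s : Set Ω) :
    μ s ≠ 0 ↔ ∃ ω ∈ s, μ {ω} ≠ 0 := by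
  constructor
  · intro h
    by_contra! hc
    refine h ?_
    rw [← Set.biUnion_of_singleton s]
    exact (measure_biUnion_null_iff s.to_countable).2 hc
  · rintro ⟨ω, hω, h⟩ h0
    exact h (measure_mono_null (by simpa using hω) h0)

variable [DiscreteMeasurableSpace Ω]

/-- The measure of a set that is the image of an injection scaling the masses by `c`. -/
theorem measure_image_of_singleton {Ω' : Type*} [MeasurableSpace Ω'] [DiscreteMeasurableSpace Ω']
    [Countable Ω'] (μ : Measure Ω) (ν : Measure Ω') (c : ℝ≥0∞) (e : Ω' → Ω)
    (he : Function.Injective e) (h : ∀ a, μ {e a} = c * ν {a}) (s : Set Ω') :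
    μ (e '' s) = c * ν s := by
  have h1 : μ (e '' s) = (μ.comap e) s := by
    rw [Measure.comap_apply _ he (fun _ _ => .of_discrete) _ .of_discrete]
  have h2 : μ.comap e = c • ν := by
    refine Measure.ext_of_singleton fun a => ?_
    rw [Measure.comap_apply _ he (fun _ _ => .of_discrete) _ .of_discrete, Set.image_singleton, h]
    rfl
  rw [h1, h2]
  rfl

theorem mutualInfo_eq_zero_iff {α β : Type*} [Countable α] [Countable β]
    (μ : Measure Ω) [IsFiniteMeasure μ] (X : Ω → α) (Y : Ω → β) :
    mutualInfo μ X Y = 0 ↔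
      ∀ x y, μ {ω | X ω = x ∧ Y ω = y} = μ {ω | X ω = x} * μ {ω | Y ω = y} := by
  let : MeasurableSpace α := ⊤
  let : MeasurableSpace β := ⊤
  have key : mutualInfo μ X Y = 0 ↔
      μ.map (fun ω => (X ω, Y ω)) = (μ.map X).prod (μ.map Y) :=
    InformationTheory.klDiv_eq_zero_iff
  rw [key, Measure.ext_iff_singleton, Prod.forall]
  refine forall₂_congr fun x y => ?_
  rw [← Set.singleton_prod_singleton, Measure.prod_prod,
    Measure.map_apply .of_discrete .of_discrete,
    Measure.map_apply .of_discrete .of_discrete, Measure.map_apply .of_discrete .of_discrete]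
  rfl

/-- Conditional independence with the denominators cleared: values of `Z` of probability zero need
no exception, as both sides vanish there. -/
theorem condMutualInfo_eq_zero_iff {α β γ : Type*} [Countable α] [Countable β]
    (μ : Measure Ω) [IsFiniteMeasure μ] (X : Ω → α) (Y : Ω → β) (Z : Ω → γ) :
    condMutualInfo μ X Y Z = 0 ↔ ∀ x y z,
      μ {ω | Z ω = z} * μ {ω | X ω = x ∧ Y ω = y ∧ Z ω = z} =
        μ {ω | X ω = x ∧ Z ω = z} * μ {ω | Y ω = y ∧ Z ω = z} := by
  rw [condMutualInfo, ENNReal.tsum_eq_zero]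
  have key : ∀ z, μ (Z ⁻¹' {z}) * mutualInfo (μ[|Z ⁻¹' {z}]) X Y = 0 ↔ ∀ x y,
      μ {ω | Z ω = z} * μ {ω | X ω = x ∧ Y ω = y ∧ Z ω = z} =
        μ {ω | X ω = x ∧ Z ω = z} * μ {ω | Y ω = y ∧ Z ω = z} := by
    intro z
    rw [mul_eq_zero, mutualInfo_eq_zero_iff]
    have hset : Z ⁻¹' {z} = {ω | Z ω = z} := rfl
    rw [hset]
    by_cases h0 : μ {ω | Z ω = z} = 0
    · have hX : ∀ x, μ {ω | X ω = x ∧ Z ω = z} = 0 := fun x =>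
        measure_mono_null (fun ω h => h.2) h0
      simp [h0, hX]
    · have hfin : μ {ω | Z ω = z} ≠ ∞ := measure_ne_top _ _
      simp only [h0, false_or]
      refine forall₂_congr fun x y => ?_
      simp only [cond_apply (MeasurableSet.of_discrete : MeasurableSet {ω | Z ω = z})]
      have e₁ : {ω | Z ω = z} ∩ {ω | X ω = x ∧ Y ω = y} =
          {ω | X ω = x ∧ Y ω = y ∧ Z ω = z} := by ext; simp; tauto
      have e₂ : {ω | Z ω = z} ∩ {ω | X ω = x} = {ω | X ω = x ∧ Z ω = z} := by ext; simp; tauto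
      have e₃ : {ω | Z ω = z} ∩ {ω | Y ω = y} = {ω | Y ω = y ∧ Z ω = z} := by ext; simp; tauto
      rw [e₁, e₂, e₃]
      generalize μ {ω | Z ω = z} = c at *
      generalize μ {ω | X ω = x ∧ Y ω = y ∧ Z ω = z} = u
      generalize μ {ω | X ω = x ∧ Z ω = z} = v
      generalize μ {ω | Y ω = y ∧ Z ω = z} = w
      have hc : c * c⁻¹ = 1 := ENNReal.mul_inv_cancel h0 hfin
      constructor
      · intro h
        calc c * u = c * c * (c⁻¹ * u) := by
              rw [mul_assoc c c, ← mul_assoc c c⁻¹, hc, one_mul]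
          _ = c * c * (c⁻¹ * v * (c⁻¹ * w)) := by rw [h]
          _ = (c * c⁻¹) * (c * c⁻¹) * (v * w) := by ring
          _ = v * w := by rw [hc]; simp
      · intro h
        calc c⁻¹ * u = c⁻¹ * (c * c⁻¹) * u := by rw [hc, mul_one]
          _ = c⁻¹ * c⁻¹ * (c * u) := by ring
          _ = c⁻¹ * c⁻¹ * (v * w) := by rw [h]
          _ = _ := by ring
  simp only [key]
  exact ⟨fun h x y z => h z x y, fun h z x y => h x y z⟩

/-- If `X` is uniform given `Z`, then `X` and `Y` are conditionally independent given `Z` exactly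
when the joint masses do not depend on the value of `X`. -/
theorem condMutualInfo_eq_zero_iff_of_uniform {β γ : Type*} [Countable β] {K : ℕ}
    (μ : Measure Ω) [IsFiniteMeasure μ] (X : Ω → Fin K) (Y : Ω → β) (Z : Ω → γ)
    (hX : ∀ x x' z, μ {ω | X ω = x ∧ Z ω = z} = μ {ω | X ω = x' ∧ Z ω = z}) :
    condMutualInfo μ X Y Z = 0 ↔ ∀ x x' y z,
      μ {ω | X ω = x ∧ Y ω = y ∧ Z ω = z} = μ {ω | X ω = x' ∧ Y ω = y ∧ Z ω = z} := by
  rw [condMutualInfo_eq_zero_iff]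
  constructor
  · intro h x x' y z
    by_cases h0 : μ {ω | Z ω = z} = 0
    · rw [measure_mono_null (fun ω h => h.2.2) h0, measure_mono_null (fun ω h => h.2.2) h0]
    · refine (ENNReal.mul_right_inj h0 (measure_ne_top _ _)).1 ?_
      rw [h, h, hX x x']
  · intro h x y z
    have split : ∀ p : Ω → Prop, μ {ω | p ω} = ∑ x', μ {ω | X ω = x' ∧ p ω} := by
      intro p
      rw [← measure_biUnion_finset _ fun _ _ => MeasurableSet.of_discrete]
      · congr 1
        ext ω
        simp
      · intro i _ j _ hij
        refine Set.disjoint_left.2 fun ω h₁ h₂ => hij ?_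
        exact h₁.1.symm.trans h₂.1
    rw [split fun ω => Z ω = z, split fun ω => Y ω = y ∧ Z ω = z,
      Finset.sum_congr rfl fun x' _ => hX x' x z, Finset.sum_congr rfl fun x' _ => h x' x y z]
    simp only [Finset.sum_const, nsmul_eq_mul]
    ring

variable [Countable Ω]

/-- The function `-x log x` vanishes on `[0, 1]` only at the endpoints, so zero entropy puts all the
mass on one value. -/
theorem entropy_eq_zero_iff {α : Type*} (μ : Measure Ω) [IsProbabilityMeasure μ] (X : Ω → α) :
    entropy μ X = 0 ↔ ∀ ω ω', μ {ω} ≠ 0 → μ {ω'} ≠ 0 → X ω = X ω' := by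
  rw [entropy, ENNReal.tsum_eq_zero]
  constructor
  · intro h ω ω' hω hω'
    have h1 := h (X ω)
    rw [ENNReal.ofReal_eq_zero] at h1
    have hpos : 0 < μ.real (X ⁻¹' {X ω}) := by
      refine ENNReal.toReal_pos ((measure_ne_zero_iff_exists _ _).2 ⟨ω, rfl, hω⟩)
        (measure_ne_top _ _)
    have hone : μ.real (X ⁻¹' {X ω}) = 1 := by
      by_contra hne
      have hlt : μ.real (X ⁻¹' {X ω}) < 1 := lt_of_le_of_ne measureReal_le_one hne
      have := Real.log_neg hpos hlt
      rw [Real.negMulLog] at h1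
      nlinarith
    have hc : μ (X ⁻¹' {X ω})ᶜ = 0 := by
      rw [prob_compl_eq_zero_iff .of_discrete]
      rw [measureReal_def] at hone
      exact (ENNReal.toReal_eq_one_iff _).1 hone
    by_contra hne
    exact (measure_ne_zero_iff_exists μ (X ⁻¹' {X ω})ᶜ).2 ⟨ω', fun h => hne h.symm, hω'⟩ hc
  · intro h x
    by_cases h0 : μ (X ⁻¹' {x}) = 0
    · simp [measureReal_def, h0]
    · obtain ⟨ω, hω, hp⟩ := (measure_ne_zero_iff_exists _ _).1 h0
      have hc : μ (X ⁻¹' {x})ᶜ = 0 := by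
        by_contra hne
        obtain ⟨ω', hω', hp'⟩ := (measure_ne_zero_iff_exists _ _).1 hne
        exact hω' ((h ω' ω hp' hp).trans hω)
      rw [prob_compl_eq_zero_iff .of_discrete] at hc
      simp [measureReal_def, hc]

/-- Turns correctness into decodability for pairs of realizations of positive probability, the form
used in both directions. -/
theorem condEntropy_eq_zero_iff {α β : Type*} (μ : Measure Ω) [IsFiniteMeasure μ]
    (X : Ω → α) (Y : Ω → β) :
    condEntropy μ X Y = 0 ↔
      ∀ ω ω', μ {ω} ≠ 0 → μ {ω'} ≠ 0 → Y ω = Y ω' → X ω = X ω' := by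
  rw [condEntropy, ENNReal.tsum_eq_zero]
  have hpos : ∀ y ω, μ[|Y ⁻¹' {y}] {ω} ≠ 0 ↔ Y ω = y ∧ μ {ω} ≠ 0 := by
    intro y ω
    rw [cond_apply .of_discrete, mul_ne_zero_iff]
    simp only [ne_eq, ENNReal.inv_eq_zero, measure_ne_top, not_false_eq_true, true_and]
    by_cases h : Y ω = y
    · rw [Set.inter_eq_self_of_subset_right (by simpa using h)]
      simp [h]
    · have : Y ⁻¹' {y} ∩ {ω} = ∅ := by
        ext ω'
        simp only [Set.mem_inter_iff, Set.mem_preimage, Set.mem_singleton_iff,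
          Set.mem_empty_iff_false, iff_false, not_and]
        rintro h' rfl
        exact h h'
      simp [h, this]
  constructor
  · intro h ω ω' hω hω' hY
    have h0 : μ (Y ⁻¹' {Y ω'}) ≠ 0 := (measure_ne_zero_iff_exists _ _).2 ⟨ω', rfl, hω'⟩
    have := cond_isProbabilityMeasure (μ := μ) h0
    have h1 := (mul_eq_zero.1 (h (Y ω'))).resolve_left h0
    rw [entropy_eq_zero_iff] at h1
    exact h1 ω ω' ((hpos _ _).2 ⟨hY, hω⟩) ((hpos _ _).2 ⟨rfl, hω'⟩)
  · intro h y
    by_cases h0 : μ (Y ⁻¹' {y}) = 0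
    · simp [h0]
    · have := cond_isProbabilityMeasure (μ := μ) h0
      rw [(entropy_eq_zero_iff _ _).2, mul_zero]
      intro ω ω' hω hω'
      rw [hpos] at hω hω'
      exact h ω ω' hω.2 hω'.2 (hω.1.trans hω'.1.symm)

end Information

/-! ### Uniform laws on finite types -/

instance (F : Type) (L K₁ K₂ : ℕ) [Finite F] : Finite (Database F L K₁ K₂) :=
  inferInstanceAs (Finite (Fin K₁ → Fin K₂ → Fin L → F))

instance (F : Type) (L K₁ K₂ : ℕ) [Nonempty F] : Nonempty (Database F L K₁ K₂) :=
  inferInstanceAs (Nonempty (Fin K₁ → Fin K₂ → Fin L → F))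

instance (F : Type) (L K₁ K₂ : ℕ) : DiscreteMeasurableSpace (Database F L K₁ K₂) :=
  ⟨fun _ => trivial⟩

section Uniform

variable {α β : Type*} [MeasurableSpace α] [DiscreteMeasurableSpace α] [Finite α]
  [MeasurableSpace β] [DiscreteMeasurableSpace β] [Finite β]

theorem uniform_apply (s : Set α) :
    (uniformOn Set.univ : Measure α) s = (s.ncard : ℝ≥0∞) / (Nat.card α : ℝ≥0∞) := by
  have := Fintype.ofFinite α
  rw [uniformOn_univ, Nat.card_eq_fintype_card, Measure.count_apply_finite _ s.toFinite,
    Set.ncard_eq_toFinset_card]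

theorem uniform_singleton (a : α) :
    (uniformOn Set.univ : Measure α) {a} = (Nat.card α : ℝ≥0∞)⁻¹ := by
  simp [uniform_apply]

instance isProbabilityMeasure_uniform [Nonempty α] :
    IsProbabilityMeasure (uniformOn Set.univ : Measure α) :=
  isProbabilityMeasure_uniformOn Set.finite_univ Set.univ_nonempty

theorem measurePreserving_uniform_equiv (e : α ≃ β) :
    MeasurePreserving e (uniformOn Set.univ) (uniformOn Set.univ) := by
  refine ⟨.of_discrete, Measure.ext fun s _ => ?_⟩
  rw [Measure.map_apply .of_discrete .of_discrete, uniform_apply, uniform_apply,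
    Nat.card_congr e, ← Set.ncard_image_of_injective _ e.injective,
    Set.image_preimage_eq _ e.surjective]

theorem uniform_prod_uniform :
    (uniformOn Set.univ : Measure α).prod (uniformOn Set.univ : Measure β) =
      uniformOn Set.univ := by
  refine Measure.ext_of_singleton fun a => ?_
  rw [← Set.singleton_prod_singleton, Measure.prod_prod, uniform_singleton, uniform_singleton,
    Set.singleton_prod_singleton, uniform_singleton, Nat.card_prod, Nat.cast_mul,
    ENNReal.mul_inv (.inr (ENNReal.natCast_ne_top _)) (.inl (ENNReal.natCast_ne_top _))]

end Uniform

/-! ### Factorization of the joint law and probabilistic form of the privacy conditions -/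

namespace Scheme

variable {F : Type} {L N K₁ K₂ : ℕ} (S : Scheme F L N K₁ K₂)

/-- The answers of all the servers, in terms of the components of the sample. -/
def answers (w : Database F L K₁ K₂) (s : S.server.Value) (i : Fin K₁) (z : S.user₁.Value)
    (j : Fin K₂) (y : S.user₂.Value) (n : Fin N) : List F :=
  S.answer n w (S.query₁ i z n) (S.query₂ j y n) s

instance : IsFiniteMeasure S.law := by
  unfold law
  infer_instance

theorem law_singleton (ω : S.Sample) :
    S.law {ω} = (uniformOn Set.univ : Measure (Database F L K₁ K₂)) {ω.1} *
      (S.server.law {ω.2.1} *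
        (((uniformOn Set.univ : Measure (Fin K₁)) {ω.2.2.1.1} * S.user₁.law {ω.2.2.1.2}) *
          ((uniformOn Set.univ : Measure (Fin K₂)) {ω.2.2.2.1} * S.user₂.law {ω.2.2.2.2}))) := by
  obtain ⟨w, s, ⟨i, z⟩, ⟨j, y⟩⟩ := ω
  simp only [law, ← Set.singleton_prod_singleton, Measure.prod_prod]

variable [Finite F]

theorem law_singleton_ne_zero_iff (ω : S.Sample) :
    S.law {ω} ≠ 0 ↔ S.server.law {S.Zs ω} ≠ 0 ∧ S.user₁.law {S.Z₁ ω} ≠ 0 ∧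
      S.user₂.law {S.Z₂ ω} ≠ 0 := by
  rw [law_singleton]
  simp [uniform_singleton, Zs, Z₁, Z₂]

/-- The components are independent, so fixing both indices and user 1's randomness only contributes
a constant factor; this prepares inter-user privacy. -/
theorem law_slice₁ (i : Fin K₁) (z : S.user₁.Value) (j : Fin K₂)
    (P : Database F L K₁ K₂ → S.server.Value → S.user₂.Value → Prop) :
    S.law {ω | S.θ₂ ω = j ∧ (S.θ₁ ω = i ∧ S.Z₁ ω = z) ∧ P (S.W ω) (S.Zs ω) (S.Z₂ ω)} =
      ((K₁ : ℝ≥0∞)⁻¹ * (K₂ : ℝ≥0∞)⁻¹ * S.user₁.law {z}) *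
        ((uniformOn Set.univ : Measure (Database F L K₁ K₂)).prod
          (S.server.law.prod S.user₂.law)) {x | P x.1 x.2.1 x.2.2} := by
  rw [← measure_image_of_singleton S.law _ _
    (fun x : Database F L K₁ K₂ × S.server.Value × S.user₂.Value =>
      (x.1, x.2.1, (i, z), (j, x.2.2)))]
  · congr 1
    ext ⟨w, s, ⟨i', z'⟩, ⟨j', y⟩⟩
    simp only [W, Zs, θ₁, θ₂, Z₁, Z₂, Set.mem_ofPred_eq, Set.mem_image, Prod.exists, Prod.mk.injEq]
    constructor
    · rintro ⟨rfl, ⟨rfl, rfl⟩, h⟩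
      exact ⟨_, _, _, h, by simp⟩
    · rintro ⟨_, _, _, h, rfl, rfl, ⟨rfl, rfl⟩, rfl, rfl⟩
      exact ⟨rfl, ⟨rfl, rfl⟩, h⟩
  · rintro ⟨w, s, y⟩ ⟨w', s', y'⟩ h
    simpa using h
  · rintro ⟨w, s, y⟩
    rw [law_singleton]
    simp only [← Set.singleton_prod_singleton, Measure.prod_prod, uniform_singleton, Nat.card_fin]
    ring

theorem law_slice₂ (j : Fin K₂) (y : S.user₂.Value) (i : Fin K₁)
    (P : Database F L K₁ K₂ → S.server.Value → S.user₁.Value → Prop) :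
    S.law {ω | S.θ₁ ω = i ∧ (S.θ₂ ω = j ∧ S.Z₂ ω = y) ∧ P (S.W ω) (S.Zs ω) (S.Z₁ ω)} =
      ((K₁ : ℝ≥0∞)⁻¹ * (K₂ : ℝ≥0∞)⁻¹ * S.user₂.law {y}) *
        ((uniformOn Set.univ : Measure (Database F L K₁ K₂)).prod
          (S.server.law.prod S.user₁.law)) {x | P x.1 x.2.1 x.2.2} := by
  rw [← measure_image_of_singleton S.law _ _
    (fun x : Database F L K₁ K₂ × S.server.Value × S.user₁.Value =>
      (x.1, x.2.1, (i, x.2.2), (j, y)))]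
  · congr 1
    ext ⟨w, s, ⟨i', z⟩, ⟨j', y'⟩⟩
    simp only [W, Zs, θ₁, θ₂, Z₁, Z₂, Set.mem_ofPred_eq, Set.mem_image, Prod.exists, Prod.mk.injEq]
    constructor
    · rintro ⟨rfl, ⟨rfl, rfl⟩, h⟩
      exact ⟨_, _, _, h, by simp⟩
    · rintro ⟨_, _, _, h, rfl, rfl, ⟨rfl, rfl⟩, rfl, rfl⟩
      exact ⟨rfl, ⟨rfl, rfl⟩, h⟩
  · rintro ⟨w, s, y⟩ ⟨w', s', y'⟩ h
    simpa using h
  · rintro ⟨w, s, y⟩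
    rw [law_singleton]
    simp only [← Set.singleton_prod_singleton, Measure.prod_prod, uniform_singleton, Nat.card_fin]
    ring

/-- For fixed database and servers' randomness the two users' events are independent; this prepares
privacy from the servers. -/
theorem law_query_slice₁ (i : Fin K₁) (w : Database F L K₁ K₂) (s : S.server.Value)
    (P : S.user₁.Value → Prop) (R : Fin K₂ → S.user₂.Value → Prop) :
    S.law {ω | S.θ₁ ω = i ∧ (P (S.Z₁ ω) ∧ R (S.θ₂ ω) (S.Z₂ ω)) ∧ S.W ω = w ∧ S.Zs ω = s} =
      ((K₁ : ℝ≥0∞)⁻¹ * (uniformOn Set.univ : Measure (Database F L K₁ K₂)) {w} *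
        S.server.law {s}) * (S.user₁.law {z | P z} *
          ((uniformOn Set.univ : Measure (Fin K₂)).prod S.user₂.law) {x | R x.1 x.2}) := by
  rw [← Measure.prod_prod, ← measure_image_of_singleton S.law _ _
    (fun x : S.user₁.Value × Fin K₂ × S.user₂.Value => (w, s, (i, x.1), x.2))]
  · congr 1
    ext ⟨w', s', ⟨i', z⟩, ⟨j, y⟩⟩
    simp only [W, Zs, θ₁, θ₂, Z₁, Z₂, Set.mem_ofPred_eq, Set.mem_image, Prod.exists, Prod.mk.injEq,
      Set.mem_prod]
    constructor
    · rintro ⟨rfl, h, rfl, rfl⟩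
      exact ⟨_, _, _, h, by simp⟩
    · rintro ⟨_, _, _, h, rfl, rfl, ⟨rfl, rfl⟩, rfl, rfl⟩
      exact ⟨rfl, h, rfl, rfl⟩
  · rintro ⟨z, y⟩ ⟨z', y'⟩ h
    simpa using h
  · rintro ⟨z, j, y⟩
    rw [law_singleton]
    simp only [← Set.singleton_prod_singleton, Measure.prod_prod, uniform_singleton, Nat.card_fin]
    ring

theorem law_query_slice₂ (j : Fin K₂) (w : Database F L K₁ K₂) (s : S.server.Value)
    (P : Fin K₁ → S.user₁.Value → Prop) (R : S.user₂.Value → Prop) :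
    S.law {ω | S.θ₂ ω = j ∧ (P (S.θ₁ ω) (S.Z₁ ω) ∧ R (S.Z₂ ω)) ∧ S.W ω = w ∧ S.Zs ω = s} =
      ((K₂ : ℝ≥0∞)⁻¹ * (uniformOn Set.univ : Measure (Database F L K₁ K₂)) {w} *
        S.server.law {s}) * (((uniformOn Set.univ : Measure (Fin K₁)).prod S.user₁.law)
          {x | P x.1 x.2} * S.user₂.law {y | R y}) := by
  rw [← Measure.prod_prod, ← measure_image_of_singleton S.law _ _
    (fun x : (Fin K₁ × S.user₁.Value) × S.user₂.Value => (w, s, x.1, (j, x.2)))]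
  · congr 1
    ext ⟨w', s', ⟨i, z⟩, ⟨j', y⟩⟩
    simp only [W, Zs, θ₁, θ₂, Z₁, Z₂, Set.mem_ofPred_eq, Set.mem_image, Prod.exists, Prod.mk.injEq,
      Set.mem_prod]
    constructor
    · rintro ⟨rfl, h, rfl, rfl⟩
      exact ⟨_, _, _, h, by simp⟩
    · rintro ⟨_, _, _, h, rfl, rfl, ⟨rfl, rfl⟩, rfl, rfl⟩
      exact ⟨rfl, h, rfl, rfl⟩
  · rintro ⟨z, y⟩ ⟨z', y'⟩ h
    simpa using h
  · rintro ⟨⟨i, z⟩, y⟩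
    rw [law_singleton]
    simp only [← Set.singleton_prod_singleton, Measure.prod_prod, uniform_singleton, Nat.card_fin]
    ring

end Scheme

/-- Exchanging two rows and two columns permutes the databases. -/
theorem Database.uniform_entry {F : Type} [Finite F] {L K₁ K₂ : ℕ} (i i' : Fin K₁) (j j' : Fin K₂)
    (m : Message F L) :
    (uniformOn Set.univ : Measure (Database F L K₁ K₂)) {w | w i j = m} =
      (uniformOn Set.univ : Measure (Database F L K₁ K₂)) {w | w i' j' = m} := by
  have sw := measurePreserving_uniform_equiv (α := Database F L K₁ K₂)
    (β := Database F L K₁ K₂)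
    (Equiv.arrowCongr (Equiv.swap i i') (Equiv.arrowCongr (Equiv.swap j j') (Equiv.refl _)))
  rw [← sw.measure_preimage MeasurableSet.of_discrete.nullMeasurableSet]
  congr 1
  ext w
  change w ((Equiv.swap i i').symm i) ((Equiv.swap j j').symm j) = m ↔ w i' j' = m
  rw [Equiv.symm_swap, Equiv.swap_apply_left, Equiv.symm_swap, Equiv.swap_apply_left]

namespace Scheme

variable {F : Type} {L N K₁ K₂ : ℕ} (S : Scheme F L N K₁ K₂) [Finite F]

theorem law_query_event₁ (𝒯 : Finset (Fin N)) (i : Fin K₁) (q : 𝒯 → S.Query₁ × S.Query₂)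
    (w : Database F L K₁ K₂) (s : S.server.Value) :
    S.law {ω | S.θ₁ ω = i ∧ (fun n : 𝒯 => S.Q ω n) = q ∧ (S.W ω, S.Zs ω) = (w, s)} =
      ((K₁ : ℝ≥0∞)⁻¹ * (uniformOn Set.univ : Measure (Database F L K₁ K₂)) {w} *
        S.server.law {s}) *
      (S.user₁.law {z | (fun n : 𝒯 => S.query₁ i z n) = fun n => (q n).1} *
        ((uniformOn Set.univ : Measure (Fin K₂)).prod S.user₂.law)
          {x | (fun n : 𝒯 => S.query₂ x.1 x.2 n) = fun n => (q n).2}) := by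
  rw [← law_query_slice₁ S i w s (fun z => (fun n : 𝒯 => S.query₁ i z n) = fun n => (q n).1)
    fun j y => (fun n : 𝒯 => S.query₂ j y n) = fun n => (q n).2]
  congr 1
  ext ω
  simp only [Set.mem_ofPred_eq, funext_iff, Q, Prod.ext_iff, forall_and]
  refine and_congr_right ?_
  rintro rfl
  rfl

theorem law_query_event₂ (𝒯 : Finset (Fin N)) (j : Fin K₂) (q : 𝒯 → S.Query₁ × S.Query₂)
    (w : Database F L K₁ K₂) (s : S.server.Value) :
    S.law {ω | S.θ₂ ω = j ∧ (fun n : 𝒯 => S.Q ω n) = q ∧ (S.W ω, S.Zs ω) = (w, s)} =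
      ((K₂ : ℝ≥0∞)⁻¹ * (uniformOn Set.univ : Measure (Database F L K₁ K₂)) {w} *
        S.server.law {s}) *
      (((uniformOn Set.univ : Measure (Fin K₁)).prod S.user₁.law)
          {x | (fun n : 𝒯 => S.query₁ x.1 x.2 n) = fun n => (q n).1} *
        S.user₂.law {y | (fun n : 𝒯 => S.query₂ j y n) = fun n => (q n).2}) := by
  rw [← law_query_slice₂ S j w s (fun i z => (fun n : 𝒯 => S.query₁ i z n) = fun n => (q n).1)
    fun y => (fun n : 𝒯 => S.query₂ j y n) = fun n => (q n).2]
  congr 1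
  ext ω
  simp only [Set.mem_ofPred_eq, funext_iff, Q, Prod.ext_iff, forall_and]
  refine and_congr_right ?_
  rintro rfl
  rfl

/-- The joint mass factors into a part for each user. For the forward direction, the factors not
involving user 1's queries are made nonzero by picking realizations of positive mass, and then
cancelled. -/
theorem private₁_iff [Nonempty F] [NeZero K₁] [NeZero K₂] (𝒯 : Finset (Fin N)) :
    condMutualInfo S.law S.θ₁ (fun ω (n : 𝒯) => S.Q ω n) (fun ω => (S.W ω, S.Zs ω)) = 0 ↔
      ∀ i i' (q : 𝒯 → S.Query₁), S.user₁.law {z | (fun n : 𝒯 => S.query₁ i z n) = q} =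
        S.user₁.law {z | (fun n : 𝒯 => S.query₁ i' z n) = q} := by
  have hu : ∀ i i' (z : Database F L K₁ K₂ × S.server.Value),
      S.law {ω | S.θ₁ ω = i ∧ (S.W ω, S.Zs ω) = z} =
        S.law {ω | S.θ₁ ω = i' ∧ (S.W ω, S.Zs ω) = z} := by
    rintro i i' ⟨w, s⟩
    have h := fun i => S.law_query_slice₁ i w s (fun _ => True) (fun _ _ => True)
    simp only [true_and] at h
    simp only [Prod.mk.injEq, h]
  rw [condMutualInfo_eq_zero_iff_of_uniform _ _ _ _ hu]
  constructor
  · intro h i i' q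
    obtain ⟨s, -, hs⟩ := (measure_ne_zero_iff_exists S.server.law Set.univ).1 (by simp)
    obtain ⟨⟨j, y⟩, -, hy⟩ := (measure_ne_zero_iff_exists
      ((uniformOn Set.univ : Measure (Fin K₂)).prod S.user₂.law) Set.univ).1 (by simp)
    obtain ⟨w⟩ : Nonempty (Database F L K₁ K₂) := inferInstance
    have h1 := h i i' (fun n => (q n, S.query₂ j y n)) (w, s)
    rw [law_query_event₁, law_query_event₁,
      ENNReal.mul_right_inj (by simp [hs, uniform_singleton])
        (ENNReal.mul_ne_top (ENNReal.mul_ne_top (by simp [NeZero.ne K₁]) (measure_ne_top _ _))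
          (measure_ne_top _ _)),
      ENNReal.mul_left_inj ?_ (measure_ne_top _ _)] at h1
    · exact h1
    · exact (measure_ne_zero_iff_exists _ _).2 ⟨(j, y), rfl, hy⟩
  · rintro h i i' q ⟨w, s⟩
    rw [law_query_event₁, law_query_event₁, h i i']

theorem private₂_iff [Nonempty F] [NeZero K₁] [NeZero K₂] (𝒯 : Finset (Fin N)) :
    condMutualInfo S.law S.θ₂ (fun ω (n : 𝒯) => S.Q ω n) (fun ω => (S.W ω, S.Zs ω)) = 0 ↔
      ∀ j j' (q : 𝒯 → S.Query₂), S.user₂.law {y | (fun n : 𝒯 => S.query₂ j y n) = q} =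
        S.user₂.law {y | (fun n : 𝒯 => S.query₂ j' y n) = q} := by
  have hu : ∀ j j' (z : Database F L K₁ K₂ × S.server.Value),
      S.law {ω | S.θ₂ ω = j ∧ (S.W ω, S.Zs ω) = z} =
        S.law {ω | S.θ₂ ω = j' ∧ (S.W ω, S.Zs ω) = z} := by
    rintro j j' ⟨w, s⟩
    have h := fun j => S.law_query_slice₂ j w s (fun _ _ => True) (fun _ => True)
    simp only [true_and] at h
    simp only [Prod.mk.injEq, h]
  rw [condMutualInfo_eq_zero_iff_of_uniform _ _ _ _ hu]
  constructor
  · intro h j j' q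
    obtain ⟨s, -, hs⟩ := (measure_ne_zero_iff_exists S.server.law Set.univ).1 (by simp)
    obtain ⟨⟨i, z⟩, -, hz⟩ := (measure_ne_zero_iff_exists
      ((uniformOn Set.univ : Measure (Fin K₁)).prod S.user₁.law) Set.univ).1 (by simp)
    obtain ⟨w⟩ : Nonempty (Database F L K₁ K₂) := inferInstance
    have h1 := h j j' (fun n => (S.query₁ i z n, q n)) (w, s)
    rw [law_query_event₂, law_query_event₂,
      ENNReal.mul_right_inj (by simp [hs, uniform_singleton])
        (ENNReal.mul_ne_top (ENNReal.mul_ne_top (by simp [NeZero.ne K₂]) (measure_ne_top _ _))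
          (measure_ne_top _ _)),
      ENNReal.mul_right_inj ?_ (measure_ne_top _ _)] at h1
    · exact h1
    · exact (measure_ne_zero_iff_exists _ _).2 ⟨(i, z), rfl, hz⟩
  · rintro h j j' q ⟨w, s⟩
    rw [law_query_event₂, law_query_event₂, h j j']

/-- The desired message has the same law for every index, so the uniform criterion applies; what
remains after cancelling constants is the joint law of answers and desired message. -/
theorem interUser₁_iff [NeZero K₁] [NeZero K₂] :
    condMutualInfo S.law S.θ₂ S.A (fun ω => (S.θ₁ ω, S.Z₁ ω, S.desired ω)) = 0 ↔
      ∀ i z, S.user₁.law {z} ≠ 0 → ∀ j j' a m,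
        ((uniformOn Set.univ : Measure (Database F L K₁ K₂)).prod (S.server.law.prod S.user₂.law))
          {x | S.answers x.1 x.2.1 i z j x.2.2 = a ∧ x.1 i j = m} =
        ((uniformOn Set.univ : Measure (Database F L K₁ K₂)).prod (S.server.law.prod S.user₂.law))
          {x | S.answers x.1 x.2.1 i z j' x.2.2 = a ∧ x.1 i j' = m} := by
  have hu : ∀ j j' (c : Fin K₁ × S.user₁.Value × Message F L),
      S.law {ω | S.θ₂ ω = j ∧ (S.θ₁ ω, S.Z₁ ω, S.desired ω) = c} =
        S.law {ω | S.θ₂ ω = j' ∧ (S.θ₁ ω, S.Z₁ ω, S.desired ω) = c} := by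
    rintro j j' ⟨i, z, m⟩
    have h : ∀ j, S.law {ω | S.θ₂ ω = j ∧ (S.θ₁ ω, S.Z₁ ω, S.desired ω) = (i, z, m)} =
        S.law {ω | S.θ₂ ω = j ∧ (S.θ₁ ω = i ∧ S.Z₁ ω = z) ∧ S.W ω i j = m} := by
      intro j
      congr 1
      ext ω
      simp only [Set.mem_ofPred_eq, Prod.mk.injEq, desired, and_assoc]
      constructor <;> (rintro ⟨rfl, rfl, rfl, h⟩; exact ⟨rfl, rfl, rfl, h⟩)
    have h' : ∀ j, ((uniformOn Set.univ : Measure (Database F L K₁ K₂)).prod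
        (S.server.law.prod S.user₂.law)) {x | x.1 i j = m} =
          (uniformOn Set.univ : Measure (Database F L K₁ K₂)) {w | w i j = m} := by
      intro j
      have e : {x : Database F L K₁ K₂ × S.server.Value × S.user₂.Value | x.1 i j = m} =
        {w | w i j = m} ×ˢ Set.univ := by ext; simp
      rw [e, Measure.prod_prod]
      simp
    rw [h, h, law_slice₁ S i z j (fun w _ _ => w i j = m),
      law_slice₁ S i z j' (fun w _ _ => w i j' = m), h', h',
      Database.uniform_entry i i j j']
  rw [condMutualInfo_eq_zero_iff_of_uniform _ _ _ _ hu]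
  have key : ∀ j a i z m,
      S.law {ω | S.θ₂ ω = j ∧ S.A ω = a ∧ (S.θ₁ ω, S.Z₁ ω, S.desired ω) = (i, z, m)} =
      ((K₁ : ℝ≥0∞)⁻¹ * (K₂ : ℝ≥0∞)⁻¹ * S.user₁.law {z}) *
        ((uniformOn Set.univ : Measure (Database F L K₁ K₂)).prod (S.server.law.prod S.user₂.law))
          {x | S.answers x.1 x.2.1 i z j x.2.2 = a ∧ x.1 i j = m} := by
    intro j a i z m
    rw [← law_slice₁ S i z j (fun w s y => S.answers w s i z j y = a ∧ w i j = m)]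
    congr 1
    ext ω
    simp only [Set.mem_ofPred_eq, Prod.mk.injEq]
    constructor
    · rintro ⟨rfl, rfl, rfl, rfl, rfl⟩
      exact ⟨rfl, ⟨rfl, rfl⟩, rfl, rfl⟩
    · rintro ⟨rfl, ⟨rfl, rfl⟩, rfl, rfl⟩
      exact ⟨rfl, rfl, rfl, rfl, rfl⟩
  constructor
  · intro h i z hz j j' a m
    have h1 := h j j' a (i, z, m)
    rwa [key, key, ENNReal.mul_right_inj (by simp [hz])
      (ENNReal.mul_ne_top (ENNReal.mul_ne_top (by simp [NeZero.ne K₁]) (by simp [NeZero.ne K₂]))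
        (measure_ne_top _ _))] at h1
  · rintro h j j' a ⟨i, z, m⟩
    rw [key, key]
    by_cases hz : S.user₁.law {z} = 0
    · simp [hz]
    · rw [h i z hz j j']

theorem interUser₂_iff [NeZero K₁] [NeZero K₂] :
    condMutualInfo S.law S.θ₁ S.A (fun ω => (S.θ₂ ω, S.Z₂ ω, S.desired ω)) = 0 ↔
      ∀ j y, S.user₂.law {y} ≠ 0 → ∀ i i' a m,
        ((uniformOn Set.univ : Measure (Database F L K₁ K₂)).prod (S.server.law.prod S.user₁.law))
          {x | S.answers x.1 x.2.1 i x.2.2 j y = a ∧ x.1 i j = m} =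
        ((uniformOn Set.univ : Measure (Database F L K₁ K₂)).prod (S.server.law.prod S.user₁.law))
          {x | S.answers x.1 x.2.1 i' x.2.2 j y = a ∧ x.1 i' j = m} := by
  have hu : ∀ i i' (c : Fin K₂ × S.user₂.Value × Message F L),
      S.law {ω | S.θ₁ ω = i ∧ (S.θ₂ ω, S.Z₂ ω, S.desired ω) = c} =
        S.law {ω | S.θ₁ ω = i' ∧ (S.θ₂ ω, S.Z₂ ω, S.desired ω) = c} := by
    rintro i i' ⟨j, y, m⟩
    have h : ∀ i, S.law {ω | S.θ₁ ω = i ∧ (S.θ₂ ω, S.Z₂ ω, S.desired ω) = (j, y, m)} =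
        S.law {ω | S.θ₁ ω = i ∧ (S.θ₂ ω = j ∧ S.Z₂ ω = y) ∧ S.W ω i j = m} := by
      intro i
      congr 1
      ext ω
      simp only [Set.mem_ofPred_eq, Prod.mk.injEq, desired, and_assoc]
      constructor <;> (rintro ⟨rfl, rfl, rfl, h⟩; exact ⟨rfl, rfl, rfl, h⟩)
    have h' : ∀ i, ((uniformOn Set.univ : Measure (Database F L K₁ K₂)).prod
        (S.server.law.prod S.user₁.law)) {x | x.1 i j = m} =
          (uniformOn Set.univ : Measure (Database F L K₁ K₂)) {w | w i j = m} := by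
      intro i
      have e : {x : Database F L K₁ K₂ × S.server.Value × S.user₁.Value | x.1 i j = m} =
        {w | w i j = m} ×ˢ Set.univ := by ext; simp
      rw [e, Measure.prod_prod]
      simp
    rw [h, h, law_slice₂ S j y i (fun w _ _ => w i j = m),
      law_slice₂ S j y i' (fun w _ _ => w i' j = m), h', h',
      Database.uniform_entry i i' j j]
  rw [condMutualInfo_eq_zero_iff_of_uniform _ _ _ _ hu]
  have key : ∀ i a j y m,
      S.law {ω | S.θ₁ ω = i ∧ S.A ω = a ∧ (S.θ₂ ω, S.Z₂ ω, S.desired ω) = (j, y, m)} =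
      ((K₁ : ℝ≥0∞)⁻¹ * (K₂ : ℝ≥0∞)⁻¹ * S.user₂.law {y}) *
        ((uniformOn Set.univ : Measure (Database F L K₁ K₂)).prod (S.server.law.prod S.user₁.law))
          {x | S.answers x.1 x.2.1 i x.2.2 j y = a ∧ x.1 i j = m} := by
    intro i a j y m
    rw [← law_slice₂ S j y i (fun w s z => S.answers w s i z j y = a ∧ w i j = m)]
    congr 1
    ext ω
    simp only [Set.mem_ofPred_eq, Prod.mk.injEq]
    constructor
    · rintro ⟨rfl, rfl, rfl, rfl, rfl⟩
      exact ⟨rfl, ⟨rfl, rfl⟩, rfl, rfl⟩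
    · rintro ⟨rfl, ⟨rfl, rfl⟩, rfl, rfl⟩
      exact ⟨rfl, rfl, rfl, rfl, rfl⟩
  constructor
  · intro h j y hy i i' a m
    have h1 := h i i' a (j, y, m)
    rwa [key, key, ENNReal.mul_right_inj (by simp [hy])
      (ENNReal.mul_ne_top (ENNReal.mul_ne_top (by simp [NeZero.ne K₁]) (by simp [NeZero.ne K₂]))
        (measure_ne_top _ _))] at h1
  · rintro h i i' a ⟨j, y, m⟩
    rw [key, key]
    by_cases hy : S.user₂.law {y} = 0
    · simp [hy]
    · rw [h j y hy i i']

/-- Inter-user privacy holds if the answers are a function of the desired message and of a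
realization of the servers' randomness scrambled by the other data. -/
theorem prod_law_answers₁ (base : Message F L → S.server.Value → Fin N → List F)
    (hbase : ∀ w i z j y, ∃ e : S.server.Value → S.server.Value,
      MeasurePreserving e S.server.law S.server.law ∧
        ∀ s, S.answers w s i z j y = base (w i j) (e s))
    (i : Fin K₁) (z : S.user₁.Value) (j : Fin K₂) (a : Fin N → List F) (m : Message F L) :
    ((uniformOn Set.univ : Measure (Database F L K₁ K₂)).prod (S.server.law.prod S.user₂.law))
      {x | S.answers x.1 x.2.1 i z j x.2.2 = a ∧ x.1 i j = m} =
    S.server.law {s | base m s = a} *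
      (uniformOn Set.univ : Measure (Database F L K₁ K₂)) {w | w i j = m} := by
  rw [Measure.prod_apply .of_discrete, ← lintegral_indicator_const .of_discrete]
  refine lintegral_congr fun w => ?_
  by_cases hw : w i j = m
  · rw [Set.indicator_of_mem (by exact hw), Measure.prod_apply_symm .of_discrete,
      ← mul_one (S.server.law _), ← measure_univ (μ := S.user₂.law), ← lintegral_const]
    refine lintegral_congr fun y => ?_
    obtain ⟨e, he, hs⟩ := hbase w i z j y
    rw [← he.measure_preimage (s := {s | base m s = a})
      MeasurableSet.of_discrete.nullMeasurableSet]
    congr 1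
    ext s
    simp [hw, hs]
  · rw [Set.indicator_of_notMem (by exact hw)]
    simp [hw]

theorem prod_law_answers₂ (base : Message F L → S.server.Value → Fin N → List F)
    (hbase : ∀ w i z j y, ∃ e : S.server.Value → S.server.Value,
      MeasurePreserving e S.server.law S.server.law ∧
        ∀ s, S.answers w s i z j y = base (w i j) (e s))
    (j : Fin K₂) (y : S.user₂.Value) (i : Fin K₁) (a : Fin N → List F) (m : Message F L) :
    ((uniformOn Set.univ : Measure (Database F L K₁ K₂)).prod (S.server.law.prod S.user₁.law))
      {x | S.answers x.1 x.2.1 i x.2.2 j y = a ∧ x.1 i j = m} =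
    S.server.law {s | base m s = a} *
      (uniformOn Set.univ : Measure (Database F L K₁ K₂)) {w | w i j = m} := by
  rw [Measure.prod_apply .of_discrete, ← lintegral_indicator_const .of_discrete]
  refine lintegral_congr fun w => ?_
  by_cases hw : w i j = m
  · rw [Set.indicator_of_mem (by exact hw), Measure.prod_apply_symm .of_discrete,
      ← mul_one (S.server.law _), ← measure_univ (μ := S.user₁.law), ← lintegral_const]
    refine lintegral_congr fun z => ?_
    obtain ⟨e, he, hs⟩ := hbase w i z j y
    rw [← he.measure_preimage (s := {s | base m s = a})
      MeasurableSet.of_discrete.nullMeasurableSet]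
    congr 1
    ext s
    simp [hw, hs]
  · rw [Set.indicator_of_notMem (by exact hw)]
    simp [hw]

end Scheme

/-! ### Monotonicity in the size of the database and existence of the limit -/

namespace Database

variable {F : Type} {L K₁ K₂ K₁' K₂' : ℕ}

/-- Replace the messages of `v` whose indices are in the range of `w` by those of `w`. -/
def overwrite (w : Database F L K₁ K₂) (v : Database F L K₁' K₂') : Database F L K₁' K₂' :=
  fun i j => if h : i.1 < K₁ ∧ j.1 < K₂ then w ⟨i, h.1⟩ ⟨j, h.2⟩ else v i j

/-- The part of a database with small indices. -/
def restrict (h₁ : K₁ ≤ K₁') (h₂ : K₂ ≤ K₂') (v : Database F L K₁' K₂') : Database F L K₁ K₂ :=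
  fun i j => v (i.castLE h₁) (j.castLE h₂)

theorem overwrite_castLE (h₁ : K₁ ≤ K₁') (h₂ : K₂ ≤ K₂') (w : Database F L K₁ K₂)
    (v : Database F L K₁' K₂') (i : Fin K₁) (j : Fin K₂) :
    overwrite w v (i.castLE h₁) (j.castLE h₂) = w i j := by
  simp [overwrite]

/-- Exchange a database with the corresponding part of a larger one. -/
def exchange (h₁ : K₁ ≤ K₁') (h₂ : K₂ ≤ K₂') :
    Equiv.Perm (Database F L K₁ K₂ × Database F L K₁' K₂') :=
  Function.Involutive.toPerm (fun p => (restrict h₁ h₂ p.2, overwrite p.1 p.2)) <| by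
    rintro ⟨w, v⟩
    refine Prod.ext ?_ ?_
    · funext i j
      exact overwrite_castLE h₁ h₂ w v i j
    · funext i j
      change dite _ _ _ = _
      split_ifs with h
      · rfl
      · exact dif_neg h

/-- The second component of the permutation `exchange` of uniform pairs is again uniform. -/
theorem measurePreserving_overwrite [Finite F] [Nonempty F] (h₁ : K₁ ≤ K₁') (h₂ : K₂ ≤ K₂') :
    MeasurePreserving (fun p : Database F L K₁ K₂ × Database F L K₁' K₂' => overwrite p.1 p.2)
      ((uniformOn Set.univ).prod (uniformOn Set.univ)) (uniformOn Set.univ) := by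
  have h := measurePreserving_uniform_equiv (exchange (F := F) (L := L) h₁ h₂)
  rw [← uniform_prod_uniform] at h
  exact measurePreserving_snd.comp h

end Database

namespace Scheme

variable {F : Type} {L N K₁ K₂ K₁' K₂' : ℕ}

/-- Use a scheme for a smaller database: the servers draw the missing messages at random. -/
def restrict [Finite F] [Nonempty F] (S : Scheme F L N K₁' K₂') (h₁ : K₁ ≤ K₁') (h₂ : K₂ ≤ K₂') :
    Scheme F L N K₁ K₂ where
  user₁ := S.user₁
  user₂ := S.user₂
  server :=
    { Value := Database F L K₁' K₂' × S.server.Value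
      law := (uniformOn Set.univ).prod S.server.law }
  Query₁ := S.Query₁
  Query₂ := S.Query₂
  query₁ i z := S.query₁ (i.castLE h₁) z
  query₂ j y := S.query₂ (j.castLE h₂) y
  answer n w q₁ q₂ s := S.answer n (w.overwrite s.1) q₁ q₂ s.2

variable [Finite F] [Nonempty F] (S : Scheme F L N K₁' K₂') (h₁ : K₁ ≤ K₁') (h₂ : K₂ ≤ K₂')

/-- The sample of the original scheme that a sample of the restricted scheme simulates. -/
def restrictSample (ω : (S.restrict h₁ h₂).Sample) : S.Sample :=
  (ω.1.overwrite ω.2.1.1, ω.2.1.2, (ω.2.2.1.1.castLE h₁, ω.2.2.1.2),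
    (ω.2.2.2.1.castLE h₂, ω.2.2.2.2))

theorem law_restrictSample_ne_zero (ω : (S.restrict h₁ h₂).Sample)
    (h : (S.restrict h₁ h₂).law {ω} ≠ 0) : S.law {S.restrictSample h₁ h₂ ω} ≠ 0 := by
  rw [law_singleton_ne_zero_iff] at h ⊢
  obtain ⟨hs, hz⟩ := h
  refine ⟨?_, hz⟩
  have e : ({(restrict S h₁ h₂).Zs ω} : Set (Database F L K₁' K₂' × S.server.Value)) =
      {ω.2.1.1} ×ˢ {ω.2.1.2} := by rw [Set.singleton_prod_singleton]; rfl
  change ((uniformOn Set.univ : Measure (Database F L K₁' K₂')).prod S.server.law)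
    {(restrict S h₁ h₂).Zs ω} ≠ 0 at hs
  rw [e, Measure.prod_prod] at hs
  exact right_ne_zero_of_mul hs

theorem measurePreserving_restrict (h₁ : K₁ ≤ K₁') (h₂ : K₂ ≤ K₂') (u : RandomSource) :
    MeasurePreserving
      (fun x : Database F L K₁ K₂ × (Database F L K₁' K₂' × S.server.Value) × u.Value =>
        (x.1.overwrite x.2.1.1, x.2.1.2, x.2.2))
      ((uniformOn Set.univ).prod (((uniformOn Set.univ).prod S.server.law).prod u.law))
      ((uniformOn Set.univ).prod (S.server.law.prod u.law)) := by
  have m₁ := (MeasurePreserving.id (uniformOn Set.univ : Measure (Database F L K₁ K₂))).prod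
    (measurePreserving_prodAssoc (uniformOn Set.univ : Measure (Database F L K₁' K₂'))
      S.server.law u.law)
  have m₂ := (measurePreserving_prodAssoc (uniformOn Set.univ : Measure (Database F L K₁ K₂))
    (uniformOn Set.univ : Measure (Database F L K₁' K₂')) (S.server.law.prod u.law)).symm
  have m₃ := (Database.measurePreserving_overwrite (F := F) (L := L) h₁ h₂).prod
    (MeasurePreserving.id (S.server.law.prod u.law))
  exact m₃.comp (m₂.comp m₁)

theorem desired_restrictSample (ω : (S.restrict h₁ h₂).Sample) :
    S.desired (S.restrictSample h₁ h₂ ω) = (S.restrict h₁ h₂).desired ω :=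
  Database.overwrite_castLE h₁ h₂ _ _ _ _

/-- The simulated database is uniform and contains the small one, so each condition pulls back along
the simulation. -/
theorem IsDBTPIR.restrict {T₁ T₂ : ℕ} [NeZero K₁] [NeZero K₂] {S : Scheme F L N K₁' K₂'}
    (hS : S.IsDBTPIR T₁ T₂) (h₁ : K₁ ≤ K₁') (h₂ : K₂ ≤ K₂') :
    (S.restrict h₁ h₂).IsDBTPIR T₁ T₂ := by
  have : NeZero K₁' := ⟨fun h => NeZero.ne K₁ (by omega)⟩
  have : NeZero K₂' := ⟨fun h => NeZero.ne K₂ (by omega)⟩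
  refine ⟨?_, ?_, ?_, ?_, ?_, ?_, ?_⟩
  · intro n ω ω' hω hω' h
    exact hS.prefixFree n _ _ (S.law_restrictSample_ne_zero h₁ h₂ ω hω)
      (S.law_restrictSample_ne_zero h₁ h₂ ω' hω') h
  · intro 𝒯 h𝒯
    rw [private₁_iff]
    intro i i' q
    exact (S.private₁_iff 𝒯).1 (hS.private₁ 𝒯 h𝒯) (i.castLE h₁) (i'.castLE h₁) q
  · intro 𝒯 h𝒯
    rw [private₂_iff]
    intro j j' q
    exact (S.private₂_iff 𝒯).1 (hS.private₂ 𝒯 h𝒯) (j.castLE h₂) (j'.castLE h₂) q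
  · rw [interUser₁_iff]
    intro i z hz j j' a m
    have h := S.interUser₁_iff.1 hS.interUser₁ (i.castLE h₁) z hz (j.castLE h₂) (j'.castLE h₂) a m
    have mp := S.measurePreserving_restrict h₁ h₂ S.user₂
    rw [← mp.measure_preimage MeasurableSet.of_discrete.nullMeasurableSet,
      ← mp.measure_preimage MeasurableSet.of_discrete.nullMeasurableSet] at h
    simp only [Set.preimage_ofPred_eq, Database.overwrite_castLE] at h
    exact h
  · rw [interUser₂_iff]
    intro j y hy i i' a m
    have h := S.interUser₂_iff.1 hS.interUser₂ (j.castLE h₂) y hy (i.castLE h₁) (i'.castLE h₁) a m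
    have mp := S.measurePreserving_restrict h₁ h₂ S.user₁
    rw [← mp.measure_preimage MeasurableSet.of_discrete.nullMeasurableSet,
      ← mp.measure_preimage MeasurableSet.of_discrete.nullMeasurableSet] at h
    simp only [Set.preimage_ofPred_eq, Database.overwrite_castLE] at h
    exact h
  · rw [condEntropy_eq_zero_iff]
    intro ω ω' hω hω' h
    rw [← desired_restrictSample, ← desired_restrictSample]
    refine (condEntropy_eq_zero_iff _ _ _).1 hS.correct₁ _ _
      (S.law_restrictSample_ne_zero h₁ h₂ ω hω) (S.law_restrictSample_ne_zero h₁ h₂ ω' hω') ?_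
    simp only [Prod.mk.injEq] at h ⊢
    exact ⟨h.1, congrArg (Fin.castLE h₁) h.2.1, h.2.2⟩
  · rw [condEntropy_eq_zero_iff]
    intro ω ω' hω hω' h
    rw [← desired_restrictSample, ← desired_restrictSample]
    refine (condEntropy_eq_zero_iff _ _ _).1 hS.correct₂ _ _
      (S.law_restrictSample_ne_zero h₁ h₂ ω hω) (S.law_restrictSample_ne_zero h₁ h₂ ω' hω') ?_
    simp only [Prod.mk.injEq] at h ⊢
    exact ⟨h.1, congrArg (Fin.castLE h₂) h.2.1, h.2.2⟩

theorem download_restrict_le : (S.restrict h₁ h₂).download ≤ S.download :=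
  iSup₂_le fun ω hω => le_iSup₂_of_le (S.restrictSample h₁ h₂ ω)
    (S.law_restrictSample_ne_zero h₁ h₂ ω hω) le_rfl

theorem rate_le_rate_restrict : S.rate ≤ (S.restrict h₁ h₂).rate := by
  unfold rate
  gcongr
  exact S.download_restrict_le h₁ h₂

end Scheme

variable (F : Type) [Finite F] [Nonempty F] (L N T₁ T₂ : ℕ)

theorem optimalRate_le_of_le {K₁ K₂ K₁' K₂' : ℕ} (hK₁ : 0 < K₁) (hK₂ : 0 < K₂)
    (h₁ : K₁ ≤ K₁') (h₂ : K₂ ≤ K₂') :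
    optimalRate F L N K₁' K₂' T₁ T₂ ≤ optimalRate F L N K₁ K₂ T₁ T₂ := by
  have : NeZero K₁ := ⟨hK₁.ne'⟩
  have : NeZero K₂ := ⟨hK₂.ne'⟩
  exact iSup₂_le fun S hS => le_iSup₂_of_le (S.restrict h₁ h₂) (hS.restrict h₁ h₂)
    (S.rate_le_rate_restrict h₁ h₂)

theorem exists_isLimitRate : ∃ r, IsLimitRate F L N T₁ T₂ r := by
  -- Monotonicity is only available for positive sizes; the value `⊤` elsewhere keeps `g` antitone
  -- without affecting the limit.
  let g : ℕ × ℕ → ℝ≥0∞ := fun K =>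
    if 0 < K.1 ∧ 0 < K.2 then optimalRate F L N K.1 K.2 T₁ T₂ else ⊤
  have hg : Antitone g := by
    rintro ⟨a, b⟩ ⟨a', b'⟩ ⟨ha, hb⟩
    by_cases h : 0 < a ∧ 0 < b
    · have h' : 0 < a' ∧ 0 < b' := ⟨h.1.trans_le ha, h.2.trans_le hb⟩
      simp only [g, h, h', and_self, if_true]
      exact optimalRate_le_of_le F L N T₁ T₂ h.1 h.2 ha hb
    · simp only [g, h, if_false, le_top]
  refine ⟨_, (tendsto_atTop_iInf hg).congr' ?_⟩
  filter_upwards [eventually_ge_atTop ((1, 1) : ℕ × ℕ)] with K hK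
  exact if_pos hK

/-! ### Kraft's inequality and source coding for families of prefix codes -/

section Coding

/-- A prefix code of nonempty words is uniquely decodable. The code `{[]}` is prefix-free but not
uniquely decodable, and is treated apart. -/
theorem kraft_of_prefixFree {F : Type*} [Fintype F] [Nonempty F] (C : Finset (List F))
    (hC : ∀ a ∈ C, ∀ b ∈ C, a <+: b → a = b) :
    ∑ a ∈ C, (1 / Fintype.card F : ℝ) ^ a.length ≤ 1 := by
  by_cases h : [] ∈ C
  · have : C = {[]} := Finset.eq_singleton_iff_unique_mem.2
      ⟨h, fun a ha => (hC [] h a ha List.nil_prefix).symm⟩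
    simp [this]
  · refine InformationTheory.kraft_mcmillan_inequality ?_
    intro l₁
    induction l₁ with
    | nil =>
      rintro (_ | ⟨b, l₂⟩) - h₂ he
      · rfl
      · have hb : b = [] := (List.append_eq_nil_iff.1 he.symm).1
        exact absurd (h₂ b (by simp)) (hb ▸ h)
    | cons a l₁ ih =>
      rintro (_ | ⟨b, l₂⟩) h₁ h₂ he
      · have ha : a = [] := (List.append_eq_nil_iff.1 he).1
        exact absurd (h₁ a (by simp)) (ha ▸ h)
      · have ha := h₁ a (by simp)
        have hb := h₂ b (by simp)
        rw [List.flatten_cons, List.flatten_cons] at he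
        have hab : a = b := by
          rcases List.prefix_or_prefix_of_prefix (List.prefix_append a l₁.flatten)
            (he ▸ List.prefix_append b l₂.flatten) with hp | hp
          · exact hC a ha b hb hp
          · exact (hC b hb a ha hp).symm
        subst hab
        rw [ih l₂ (fun x hx => h₁ x (by simp [hx])) (fun x hx => h₂ x (by simp [hx]))
          (List.append_cancel_left he)]

/-- Converse of source coding for a uniform source encoded by a family of prefix codes. -/
theorem mul_card_le_sum_length {F Ω ι : Type*} [Fintype F] [Nontrivial F] [Fintype Ω] [Fintype ι]
    (c : ι → Ω → List F) (hc : ∀ i ω ω', c i ω <+: c i ω' → c i ω = c i ω')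
    (hinj : ∀ ω ω', (∀ i, c i ω = c i ω') → ω = ω') (M : ℕ)
    (hM : Fintype.card Ω = Fintype.card F ^ M) :
    M * Fintype.card Ω ≤ ∑ ω, ∑ i, (c i ω).length := by
  classical
  set q : ℝ := (Fintype.card F : ℝ) with hq
  have hq1 : 1 < q := by
    rw [hq]
    exact_mod_cast Fintype.one_lt_card
  have hq0 : 0 < q := by linarith
  have hlog : 0 < Real.log q := Real.log_pos hq1
  -- The tuples of codewords that occur are distinct and form part of a product of codes, whose
  -- Kraft sum is the product of the individual ones.
  have kraft : ∑ ω, (1 / q) ^ (∑ i, (c i ω).length) ≤ 1 := by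
    calc ∑ ω, (1 / q) ^ (∑ i, (c i ω).length)
        = ∑ ω, ∏ i, (1 / q) ^ (c i ω).length := by simp only [Finset.prod_pow_eq_pow_sum]
      _ = ∑ a ∈ Finset.univ.image (fun ω i => c i ω), ∏ i, (1 / q) ^ (a i).length := by
          rw [Finset.sum_image]
          intro ω _ ω' _ h
          exact hinj ω ω' (congrFun h)
      _ ≤ ∑ a ∈ Fintype.piFinset fun i => Finset.univ.image (c i),
            ∏ i, (1 / q) ^ (a i).length := by
          refine Finset.sum_le_sum_of_subset_of_nonneg ?_ fun _ _ _ => by positivity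
          intro a ha
          obtain ⟨ω, -, rfl⟩ := Finset.mem_image.1 ha
          exact Fintype.mem_piFinset.2 fun i => Finset.mem_image_of_mem _ (Finset.mem_univ _)
      _ = ∏ i, ∑ a ∈ Finset.univ.image (c i), (1 / q) ^ a.length :=
          (Finset.prod_univ_sum (fun i => Finset.univ.image (c i))
            fun _ a => (1 / q) ^ a.length).symm
      _ ≤ 1 := by
          refine Finset.prod_le_one (fun _ _ => Finset.sum_nonneg fun _ _ => by positivity) ?_
          intro i _
          refine kraft_of_prefixFree _ ?_
          intro a ha b hb
          obtain ⟨ω, -, rfl⟩ := Finset.mem_image.1 ha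
          obtain ⟨ω', -, rfl⟩ := Finset.mem_image.1 hb
          exact hc i ω ω'
  -- The bound `1 + x ≤ exp x` at `x = (M - ℓ) log q`. Summed over `ω` and combined with Kraft's
  -- inequality, it bounds the mean length below by `M`, with no entropy involved.
  have tangent : ∀ ℓ : ℕ, 1 - ((ℓ : ℝ) - M) * Real.log q ≤ q ^ M * (1 / q) ^ ℓ := by
    intro ℓ
    have h1 := Real.add_one_le_exp (-(((ℓ : ℝ) - M) * Real.log q))
    have h2 : Real.exp (-(((ℓ : ℝ) - M) * Real.log q)) = q ^ M * (1 / q) ^ ℓ := by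
      have : -(((ℓ : ℝ) - M) * Real.log q) = M * Real.log q - ℓ * Real.log q := by ring
      rw [this, Real.exp_sub, Real.exp_nat_mul, Real.exp_nat_mul, Real.exp_log hq0, one_div,
        inv_pow, div_eq_mul_inv]
    linarith
  have hΩ : (Fintype.card Ω : ℝ) = q ^ M := by rw [hM, hq]; push_cast; rfl
  have hsum := Finset.sum_le_sum fun ω (_ : ω ∈ Finset.univ) => tangent (∑ i, (c i ω).length)
  rw [← Finset.mul_sum, Finset.sum_sub_distrib, ← Finset.sum_mul, Finset.sum_sub_distrib] at hsum
  simp only [Finset.sum_const, Finset.card_univ, nsmul_eq_mul, mul_one] at hsum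
  have h3 : q ^ M * ∑ ω, (1 / q) ^ (∑ i, (c i ω).length) ≤ q ^ M :=
    mul_le_of_le_one_right (by positivity) kraft
  have h4 : 0 ≤ ((∑ ω, ((∑ i, (c i ω).length : ℕ) : ℝ)) - Fintype.card Ω * M) * Real.log q := by
    rw [hΩ] at hsum ⊢
    linarith
  have h5 := nonneg_of_mul_nonneg_left h4 hlog
  have : (M * Fintype.card Ω : ℝ) ≤ ∑ ω, ((∑ i, (c i ω).length : ℕ) : ℝ) := by linarith
  exact_mod_cast this

end Coding

/-! ### Selecting realizations and servers by averaging -/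

section Averaging

variable {Z : Type*} [MeasurableSpace Z] [Countable Z]

theorem measure_setOf_singleton_eq_zero (μ : Measure Z) : μ {z | μ {z} = 0} = 0 := by
  by_contra h
  obtain ⟨z, hz, hz'⟩ := (measure_ne_zero_iff_exists _ _).1 h
  exact hz' hz

variable [DiscreteMeasurableSpace Z]

/-- If the law of `X i` does not depend on `i`, then there are points of positive mass at which all
`X i` agree and the sum of the `g i` does not exceed its mean. -/
theorem exists_selection {Q : Type*} [Countable Q] (μ : Measure Z) [IsProbabilityMeasure μ] {K : ℕ}
    [NeZero K] (X : Fin K → Z → Q)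
    (hX : ∀ i i' q, μ {z | X i z = q} = μ {z | X i' z = q}) (g : Fin K → Z → ℝ≥0∞) :
    ∃ ζ : Fin K → Z, (∀ i, μ {ζ i} ≠ 0) ∧ (∀ i i', X i (ζ i) = X i' (ζ i')) ∧
      ∑ i, g i (ζ i) ≤ ∑ i, ∫⁻ z, g i z ∂μ := by
  let : MeasurableSpace Q := ⊤
  set ν : Measure Q := μ.map (X 0)
  have hν : ∀ i q, ν {q} = μ {z | X i z = q} := by
    intro i q
    rw [hX i 0, Measure.map_apply .of_discrete .of_discrete]
    rfl
  have : IsProbabilityMeasure ν :=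
    Measure.isProbabilityMeasure_map (Measurable.of_discrete).aemeasurable
  have hne : Nonempty Z := by
    obtain ⟨z, -⟩ := nonempty_of_measure_ne_zero (μ := μ) (s := Set.univ) (by simp)
    exact ⟨z⟩
  -- On each fibre of `X i`, some point of positive mass has `g i` at most its conditional mean.
  have sel : ∀ q i, ∃ z, ν {q} ≠ 0 → X i z = q ∧ μ {z} ≠ 0 ∧
      g i z * ν {q} ≤ ∫⁻ z in {z | X i z = q}, g i z ∂μ := by
    intro q i
    by_cases hq : ν {q} = 0
    · exact ⟨hne.some, fun h => absurd hq h⟩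
    · have hr : μ.restrict {z | X i z = q} ≠ 0 := by
        rw [ne_eq, Measure.restrict_eq_zero, ← hν]
        exact hq
      have hN : μ.restrict {z | X i z = q} ({z | μ {z} = 0} ∪ {z | X i z = q}ᶜ) = 0 := by
        refine measure_union_null ?_ ?_
        · exact Measure.absolutelyContinuous_of_le Measure.restrict_le_self
            (measure_setOf_singleton_eq_zero μ)
        · rw [Measure.restrict_apply .of_discrete, Set.compl_inter_self, measure_empty]
      obtain ⟨z, hz, hle⟩ := exists_notMem_null_le_laverage hr
        (Measurable.of_discrete (f := g i)).aemeasurable hN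
      rw [Set.mem_union, not_or] at hz
      refine ⟨z, fun _ => ⟨not_not.1 hz.2, hz.1, ?_⟩⟩
      rw [laverage_eq, Measure.restrict_apply_univ, ← hν] at hle
      exact ENNReal.mul_le_of_le_div hle
  choose ζ hζ using sel
  -- A common value `q` is chosen by averaging over `ν`, the shared law of all the `X i`; the
  -- conditional means then recombine to the full integrals.
  obtain ⟨q, hq, hle⟩ := exists_notMem_null_le_lintegral (μ := ν)
    (Measurable.of_discrete (f := fun q => ∑ i, g i (ζ q i))).aemeasurable
    (measure_setOf_singleton_eq_zero ν)
  refine ⟨ζ q, fun i => (hζ q i hq).2.1, fun i i' => (hζ q i hq).1.trans (hζ q i' hq).1.symm,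
    hle.trans ?_⟩
  rw [lintegral_countable']
  calc ∑' q, (∑ i, g i (ζ q i)) * ν {q}
      ≤ ∑' q, ∑ i, ∫⁻ z in {z | X i z = q}, g i z ∂μ := by
        refine ENNReal.tsum_le_tsum fun q => ?_
        by_cases hq : ν {q} = 0
        · simp [hq]
        · rw [Finset.sum_mul]
          exact Finset.sum_le_sum fun i _ => (hζ q i hq).2.2
    _ = ∑ i, ∑' q, ∫⁻ z in {z | X i z = q}, g i z ∂μ :=
        Summable.tsum_finsetSum fun _ _ => ENNReal.summable
    _ = ∑ i, ∫⁻ z, g i z ∂μ := by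
        refine Finset.sum_congr rfl fun i _ => ?_
        rw [← lintegral_iUnion (fun _ => .of_discrete)]
        · have : ⋃ q, {z | X i z = q} = Set.univ := by ext; simp
          rw [this, Measure.restrict_univ]
        · intro q q' hqq
          exact Set.disjoint_left.2 fun z h h' => hqq (h.symm.trans h')

/-- The `m` smallest of finitely many numbers have at most the average of all of them. -/
theorem exists_subset_card_mul_sum_le {ι : Type*} (s : Finset ι) (f : ι → ℝ≥0∞) (m : ℕ)
    (hm : m ≤ s.card) : ∃ t ⊆ s, t.card = m ∧ s.card * ∑ i ∈ t, f i ≤ m * ∑ i ∈ s, f i := by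
  classical
  induction s using Finset.strongInduction with
  | H s ih =>
    rcases hm.eq_or_lt with rfl | hlt
    · exact ⟨s, subset_rfl, rfl, le_rfl⟩
    · have hs : s.Nonempty := Finset.card_pos.1 (by omega)
      obtain ⟨a, ha, hmax⟩ := s.exists_max_image f hs
      have hcard := Finset.card_erase_add_one ha
      obtain ⟨t, hts, htm, ht⟩ := ih _ (Finset.erase_ssubset ha) (by omega)
      refine ⟨t, hts.trans (Finset.erase_subset _ _), htm, ?_⟩
      -- The largest element `a` was discarded, so it dominates every element of `t`; adding this to
      -- the induction hypothesis raises the factor from `s.card - 1` to `s.card`.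
      have h1 : ∑ i ∈ t, f i ≤ m * f a := by
        rw [← htm, ← nsmul_eq_mul]
        exact Finset.sum_le_card_nsmul _ _ _ fun i hi =>
          hmax i (Finset.mem_of_mem_erase (hts hi))
      rw [← hcard, ← Finset.sum_erase_add _ _ ha, Nat.cast_add, Nat.cast_one, add_mul, one_mul,
        mul_add]
      exact add_le_add ht h1

end Averaging

/-! ### The converse bound -/

namespace Scheme

variable {F : Type} {L N K₁ K₂ : ℕ} (S : Scheme F L N K₁ K₂) [Finite F]

/-- The sum of the values of `f` over all databases and indices, averaged over the randomness of the
servers and of the users. -/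
def total (f : Database F L K₁ K₂ → S.server.Value → Fin K₁ → S.user₁.Value → Fin K₂ →
    S.user₂.Value → ℝ≥0∞) : ℝ≥0∞ :=
  letI := Fintype.ofFinite (Database F L K₁ K₂)
  ∫⁻ s, ∑ i, ∫⁻ z, ∑ j, ∫⁻ y, ∑ w, f w s i z j y ∂S.user₂.law ∂S.user₁.law ∂S.server.law

theorem total_sum {ι : Type*} (R : Finset ι) (f : ι → Database F L K₁ K₂ → S.server.Value →
    Fin K₁ → S.user₁.Value → Fin K₂ → S.user₂.Value → ℝ≥0∞) :
    S.total (fun w s i z j y => ∑ n ∈ R, f n w s i z j y) = ∑ n ∈ R, S.total (f n) := by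
  simp only [total]
  rw [← lintegral_finsetSum _ fun _ _ => .of_discrete]
  refine lintegral_congr fun s => ?_
  rw [Finset.sum_comm]
  refine Finset.sum_congr rfl fun i _ => ?_
  rw [← lintegral_finsetSum _ fun _ _ => .of_discrete]
  refine lintegral_congr fun z => ?_
  rw [Finset.sum_comm]
  refine Finset.sum_congr rfl fun j _ => ?_
  rw [← lintegral_finsetSum _ fun _ _ => .of_discrete]
  refine lintegral_congr fun y => ?_
  rw [Finset.sum_comm]

theorem ae_singleton_ne_zero {Z : Type*} [MeasurableSpace Z] [Countable Z] (μ : Measure Z) :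
    ∀ᵐ z ∂μ, μ {z} ≠ 0 := by
  rw [ae_iff]
  simpa using measure_setOf_singleton_eq_zero μ

theorem total_le (f : Database F L K₁ K₂ → S.server.Value → Fin K₁ → S.user₁.Value → Fin K₂ →
    S.user₂.Value → ℝ≥0∞) (c : ℝ≥0∞)
    (h : ∀ w s i z j y, S.server.law {s} ≠ 0 → S.user₁.law {z} ≠ 0 → S.user₂.law {y} ≠ 0 →
      f w s i z j y ≤ c) :
    S.total f ≤ K₁ * (K₂ * (Nat.card (Database F L K₁ K₂) * c)) := by
  let := Fintype.ofFinite (Database F L K₁ K₂)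
  have bound : ∀ {Z : Type} [MeasurableSpace Z] [Countable Z] (μ : Measure Z)
      [IsProbabilityMeasure μ] (g : Z → ℝ≥0∞) (b : ℝ≥0∞), (∀ z, μ {z} ≠ 0 → g z ≤ b) →
      ∫⁻ z, g z ∂μ ≤ b := by
    intro Z _ _ μ _ g b hg
    calc ∫⁻ z, g z ∂μ ≤ ∫⁻ _, b ∂μ :=
          lintegral_mono_ae ((ae_singleton_ne_zero μ).mono hg)
      _ = b := by simp
  have sum_bound : ∀ {ι : Type} [Fintype ι] (g : ι → ℝ≥0∞) (b : ℝ≥0∞), (∀ i, g i ≤ b) →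
      ∑ i, g i ≤ Nat.card ι * b := by
    intro ι _ g b hg
    rw [Nat.card_eq_fintype_card, ← nsmul_eq_mul]
    exact Finset.sum_le_card_nsmul _ _ _ fun i _ => hg i
  refine bound _ _ _ fun s hs => (sum_bound _ (K₂ * (Nat.card (Database F L K₁ K₂) * c)) ?_).trans
    (by simp)
  refine fun i => bound _ _ _ fun z hz => (sum_bound _ (Nat.card (Database F L K₁ K₂) * c) ?_).trans
    (by simp)
  exact fun j => bound _ _ _ fun y hy => sum_bound _ c fun w => h w s i z j y hs hz hy

/-- Realizations of the randomness at which the users' queries to `𝒯₁` and `𝒯₂`, respectively, do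
not depend on the indices, and at which `f` does not exceed its average. -/
theorem exists_realization [Fintype (Database F L K₁ K₂)] [NeZero K₁] [NeZero K₂]
    (𝒯₁ 𝒯₂ : Finset (Fin N))
    (h₁ : ∀ i i' (q : 𝒯₁ → S.Query₁), S.user₁.law {z | (fun n : 𝒯₁ => S.query₁ i z n) = q} =
      S.user₁.law {z | (fun n : 𝒯₁ => S.query₁ i' z n) = q})
    (h₂ : ∀ j j' (q : 𝒯₂ → S.Query₂), S.user₂.law {y | (fun n : 𝒯₂ => S.query₂ j y n) = q} =
      S.user₂.law {y | (fun n : 𝒯₂ => S.query₂ j' y n) = q})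
    (f : Database F L K₁ K₂ → S.server.Value → Fin K₁ → S.user₁.Value → Fin K₂ →
      S.user₂.Value → ℝ≥0∞) :
    ∃ (s : S.server.Value) (ζ₁ : Fin K₁ → S.user₁.Value) (ζ₂ : Fin K₂ → S.user₂.Value),
      S.server.law {s} ≠ 0 ∧ (∀ i, S.user₁.law {ζ₁ i} ≠ 0) ∧ (∀ j, S.user₂.law {ζ₂ j} ≠ 0) ∧
      (∀ i i', ∀ n ∈ 𝒯₁, S.query₁ i (ζ₁ i) n = S.query₁ i' (ζ₁ i') n) ∧
      (∀ j j', ∀ n ∈ 𝒯₂, S.query₂ j (ζ₂ j) n = S.query₂ j' (ζ₂ j') n) ∧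
      ∑ i, ∑ j, ∑ w, f w s i (ζ₁ i) j (ζ₂ j) ≤ S.total f := by
  obtain ⟨s, hs, hle⟩ := exists_notMem_null_le_lintegral (μ := S.server.law)
    (Measurable.of_discrete (f := fun s => ∑ i, ∫⁻ z, ∑ j, ∫⁻ y, ∑ w, f w s i z j y
      ∂S.user₂.law ∂S.user₁.law)).aemeasurable (measure_setOf_singleton_eq_zero _)
  -- The choices are successive: `ζ₁` while user 2's randomness is still averaged, then `ζ₂` with
  -- `ζ₁` fixed and the sum over `i` inside the objective.
  obtain ⟨ζ₁, hζ₁, hq₁, hle₁⟩ := exists_selection S.user₁.law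
    (fun i z (n : 𝒯₁) => S.query₁ i z n) h₁
    fun i z => ∑ j, ∫⁻ y, ∑ w, f w s i z j y ∂S.user₂.law
  obtain ⟨ζ₂, hζ₂, hq₂, hle₂⟩ := exists_selection S.user₂.law
    (fun j y (n : 𝒯₂) => S.query₂ j y n) h₂
    fun j y => ∑ i, ∑ w, f w s i (ζ₁ i) j y
  refine ⟨s, ζ₁, ζ₂, hs, hζ₁, hζ₂, fun i i' n hn => congrFun (hq₁ i i') ⟨n, hn⟩,
    fun j j' n hn => congrFun (hq₂ j j') ⟨n, hn⟩, ?_⟩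
  calc ∑ i, ∑ j, ∑ w, f w s i (ζ₁ i) j (ζ₂ j)
      = ∑ j, ∑ i, ∑ w, f w s i (ζ₁ i) j (ζ₂ j) := Finset.sum_comm
    _ ≤ ∑ j, ∫⁻ y, ∑ i, ∑ w, f w s i (ζ₁ i) j y ∂S.user₂.law := hle₂
    _ = ∑ j, ∑ i, ∫⁻ y, ∑ w, f w s i (ζ₁ i) j y ∂S.user₂.law :=
        Finset.sum_congr rfl fun j _ => lintegral_finsetSum _ fun _ _ => .of_discrete
    _ = ∑ i, ∑ j, ∫⁻ y, ∑ w, f w s i (ζ₁ i) j y ∂S.user₂.law := Finset.sum_comm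
    _ ≤ _ := hle₁
    _ ≤ _ := hle
    _ = S.total f := by
        rw [total]
        congr!

variable {S}

/-- The messages can be recovered from the answers of `𝒯₁`, which depend on the index of user 2
only, those of `𝒯₂`, which depend on the index of user 1 only, and those of the other servers. -/
theorem mul_card_le_of_realization [Nontrivial F] [Fintype (Database F L K₁ K₂)]
    [NeZero K₁] [NeZero K₂] {T₁ T₂ : ℕ} (hS : S.IsDBTPIR T₁ T₂) (d : ℕ)
    (hd : S.download ≤ d) (𝒯₁ 𝒯₂ R : Finset (Fin N)) (hcover : ∀ n, n ∈ 𝒯₁ ∨ n ∈ 𝒯₂ ∨ n ∈ R)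
    (s : S.server.Value) (ζ₁ : Fin K₁ → S.user₁.Value) (ζ₂ : Fin K₂ → S.user₂.Value)
    (hs : S.server.law {s} ≠ 0) (hζ₁ : ∀ i, S.user₁.law {ζ₁ i} ≠ 0)
    (hζ₂ : ∀ j, S.user₂.law {ζ₂ j} ≠ 0)
    (hq₁ : ∀ i i', ∀ n ∈ 𝒯₁, S.query₁ i (ζ₁ i) n = S.query₁ i' (ζ₁ i') n)
    (hq₂ : ∀ j j', ∀ n ∈ 𝒯₂, S.query₂ j (ζ₂ j) n = S.query₂ j' (ζ₂ j') n) :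
    K₁ * (K₂ * L) * Fintype.card (Database F L K₁ K₂) ≤
      Fintype.card (Database F L K₁ K₂) * ((K₁ + K₂) * d) +
        ∑ i, ∑ j, ∑ w, ∑ n ∈ R, (S.answers w s i (ζ₁ i) j (ζ₂ j) n).length := by
  let := Fintype.ofFinite F
  let σ : Database F L K₁ K₂ → Fin K₁ → Fin K₂ → S.Sample := fun w i j =>
    (w, s, (i, ζ₁ i), (j, ζ₂ j))
  have hσ : ∀ w i j, S.law {σ w i j} ≠ 0 := fun w i j =>
    (S.law_singleton_ne_zero_iff _).2 ⟨hs, hζ₁ i, hζ₂ j⟩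
  have hlen : ∀ w i j, ∑ n, (S.answers w s i (ζ₁ i) j (ζ₂ j) n).length ≤ d := by
    intro w i j
    have h := (le_iSup₂ (f := fun (ω : S.Sample) (_ : S.law {ω} ≠ 0) =>
      ((∑ n, (S.A ω n).length : ℕ) : ℕ∞)) (σ w i j) (hσ w i j)).trans hd
    exact_mod_cast h
  have hlen' : ∀ (𝒯 : Finset (Fin N)) w i j,
      ∑ n : 𝒯, (S.answers w s i (ζ₁ i) j (ζ₂ j) n).length ≤ d := by
    intro 𝒯 w i j
    refine le_trans ?_ (hlen w i j)
    rw [Finset.sum_coe_sort 𝒯 fun n => (S.answers w s i (ζ₁ i) j (ζ₂ j) n).length]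
    exact Finset.sum_le_sum_of_subset (Finset.subset_univ _)
  -- The encoders of the database. Since user 1's queries to `𝒯₁` agree for all `i`, index `0`
  -- represents them all; likewise for user 2 and `𝒯₂`.
  let c : (𝒯₁ × Fin K₂) ⊕ (𝒯₂ × Fin K₁) ⊕ (R × Fin K₁ × Fin K₂) → Database F L K₁ K₂ → List F
    | .inl (n, j), w => S.answers w s 0 (ζ₁ 0) j (ζ₂ j) n
    | .inr (.inl (n, i)), w => S.answers w s i (ζ₁ i) 0 (ζ₂ 0) n
    | .inr (.inr (n, i, j)), w => S.answers w s i (ζ₁ i) j (ζ₂ j) n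
  have key := mul_card_le_sum_length c ?_ ?_ (K₁ * (K₂ * L)) ?_
  · refine key.trans ?_
    simp only [Fintype.sum_sum_type, Finset.sum_add_distrib, ← add_assoc, c]
    refine add_le_add ?_ (le_of_eq ?_)
    · rw [← Finset.sum_add_distrib, ← smul_eq_mul (Fintype.card _)]
      refine Finset.sum_le_card_nsmul _ _ _ fun w _ => ?_
      rw [Fintype.sum_prod_type_right, Fintype.sum_prod_type_right, add_comm, add_mul]
      refine add_le_add ?_ ?_
      · exact (Finset.sum_le_card_nsmul _ _ _ fun i _ => hlen' 𝒯₂ w i 0).trans (by simp)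
      · exact (Finset.sum_le_card_nsmul _ _ _ fun j _ => hlen' 𝒯₁ w 0 j).trans (by simp)
    · calc _ = ∑ w, ∑ i, ∑ j, ∑ n ∈ R, (S.answers w s i (ζ₁ i) j (ζ₂ j) n).length := by
            refine Finset.sum_congr rfl fun w _ => ?_
            rw [Fintype.sum_prod_type_right, Fintype.sum_prod_type]
            exact Finset.sum_congr rfl fun i _ => Finset.sum_congr rfl fun j _ =>
              Finset.sum_coe_sort R fun n => (S.answers w s i (ζ₁ i) j (ζ₂ j) n).length
        _ = _ := by
            rw [Finset.sum_comm]
            exact Finset.sum_congr rfl fun i _ => Finset.sum_comm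
  · rintro (⟨n, j⟩ | ⟨n, i⟩ | ⟨n, i, j⟩) w w' h
    · exact hS.prefixFree n (σ w 0 j) (σ w' 0 j) (hσ _ _ _) (hσ _ _ _) h
    · exact hS.prefixFree n (σ w i 0) (σ w' i 0) (hσ _ _ _) (hσ _ _ _) h
    · exact hS.prefixFree n (σ w i j) (σ w' i j) (hσ _ _ _) (hσ _ _ _) h
  · intro w w' h
    funext i j
    refine (condEntropy_eq_zero_iff _ _ _).1 hS.correct₁ (σ w i j) (σ w' i j) (hσ _ _ _)
      (hσ _ _ _) ?_
    -- Index and randomness of user 1 coincide in the two samples, so equal answers force equal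
    -- messages at `(i, j)`.
    suffices S.A (σ w i j) = S.A (σ w' i j) by
      rw [Prod.mk.injEq]
      exact ⟨this, rfl⟩
    funext n
    change S.answer n w (S.query₁ i (ζ₁ i) n) (S.query₂ j (ζ₂ j) n) s =
      S.answer n w' (S.query₁ i (ζ₁ i) n) (S.query₂ j (ζ₂ j) n) s
    rcases hcover n with hn | hn | hn
    · rw [hq₁ i 0 n hn]
      exact h (.inl (⟨n, hn⟩, j))
    · rw [hq₂ j 0 n hn]
      exact h (.inr (.inl (⟨n, hn⟩, i)))
    · exact h (.inr (.inr (⟨n, hn⟩, i, j)))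
  · rw [← Nat.card_eq_fintype_card, ← Nat.card_eq_fintype_card]
    change Nat.card (Fin K₁ → Fin K₂ → Fin L → F) = _
    simp only [Nat.card_fun, Nat.card_fin]
    ring

/-- The finite-size converse in natural numbers, cleared of denominators. Truncated subtraction
covers `N ≤ T₁ + T₂`, where `R` is empty. -/
theorem mul_le_download_mul [Nontrivial F] [NeZero K₁] [NeZero K₂] {T₁ T₂ : ℕ}
    (hS : S.IsDBTPIR T₁ T₂) (d : ℕ) (hd : S.download ≤ d) :
    N * (K₁ * (K₂ * L)) ≤ d * (N * (K₁ + K₂) + (N - (T₁ + T₂)) * (K₁ * K₂)) := by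
  classical
  let := Fintype.ofFinite (Database F L K₁ K₂)
  set m := N - (T₁ + T₂) with hm
  let f : Fin N → Database F L K₁ K₂ → S.server.Value → Fin K₁ → S.user₁.Value → Fin K₂ →
    S.user₂.Value → ℝ≥0∞ := fun n w s i z j y => ((S.answers w s i z j y n).length : ℝ≥0∞)
  -- `R` has to be fixed before the realizations, because these depend on its complement; hence it
  -- is chosen by mean download.
  obtain ⟨R, -, hR, hRle⟩ := exists_subset_card_mul_sum_le Finset.univ (fun n => S.total (f n)) m
    (by simp [hm])
  rw [Finset.card_univ, Fintype.card_fin] at hRle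
  have hRc : Rᶜ.card ≤ T₁ + T₂ := by
    rw [Finset.card_compl, Fintype.card_fin, hR, hm]
    omega
  -- `𝒯₁` takes up to `T₁` servers of the complement of `R`, leaving at most `T₂` for `𝒯₂`.
  obtain ⟨𝒯₁, h𝒯, hc₁⟩ := Finset.exists_subset_card_eq (min_le_left Rᶜ.card T₁)
  have hc₂ : (Rᶜ \ 𝒯₁).card ≤ T₂ := by
    rw [Finset.card_sdiff_of_subset h𝒯, hc₁]
    omega
  obtain ⟨s, ζ₁, ζ₂, hs, hζ₁, hζ₂, hq₁, hq₂, hle⟩ := S.exists_realization 𝒯₁ (Rᶜ \ 𝒯₁)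
    ((S.private₁_iff _).1 (hS.private₁ _ (hc₁ ▸ min_le_right _ _)))
    ((S.private₂_iff _).1 (hS.private₂ _ hc₂)) (fun w s i z j y => ∑ n ∈ R, f n w s i z j y)
  have hcode := mul_card_le_of_realization hS d hd 𝒯₁ (Rᶜ \ 𝒯₁) R
    (fun n => by simp only [Finset.mem_sdiff, Finset.mem_compl]; tauto) s ζ₁ ζ₂ hs hζ₁ hζ₂ hq₁ hq₂
  have hall : S.total (fun w s i z j y => ∑ n, f n w s i z j y) ≤
      K₁ * (K₂ * (Nat.card (Database F L K₁ K₂) * (d : ℝ≥0∞))) := by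
    refine S.total_le _ _ fun w s i z j y hs hz hy => ?_
    have h := (le_iSup₂ (f := fun (ω : S.Sample) (_ : S.law {ω} ≠ 0) =>
      ((∑ n, (S.A ω n).length : ℕ) : ℕ∞)) (w, s, (i, z), (j, y))
      ((S.law_singleton_ne_zero_iff _).2 ⟨hs, hz, hy⟩)).trans hd
    have h' : ∑ n, (S.answers w s i z j y n).length ≤ d := by exact_mod_cast h
    simp only [f]
    exact_mod_cast h'
  rw [total_sum] at hle hall
  have hrest : N * ∑ i, ∑ j, ∑ w, ∑ n ∈ R, (S.answers w s i (ζ₁ i) j (ζ₂ j) n).length ≤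
      m * (K₁ * (K₂ * (Fintype.card (Database F L K₁ K₂) * d))) := by
    have h : (N : ℝ≥0∞) * ∑ i, ∑ j, ∑ w, ∑ n ∈ R, f n w s i (ζ₁ i) j (ζ₂ j) ≤
        m * (K₁ * (K₂ * (Nat.card (Database F L K₁ K₂) * (d : ℝ≥0∞)))) :=
      (mul_le_mul_right hle _).trans (hRle.trans (mul_le_mul_right hall _))
    simp only [f, Nat.card_eq_fintype_card] at h
    exact_mod_cast h
  refine Nat.le_of_mul_le_mul_left ?_ (Fintype.card_pos (α := Database F L K₁ K₂))
  calc Fintype.card (Database F L K₁ K₂) * (N * (K₁ * (K₂ * L)))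
      = N * (K₁ * (K₂ * L) * Fintype.card (Database F L K₁ K₂)) := by ring
    _ ≤ N * (Fintype.card (Database F L K₁ K₂) * ((K₁ + K₂) * d) +
        ∑ i, ∑ j, ∑ w, ∑ n ∈ R, (S.answers w s i (ζ₁ i) j (ζ₂ j) n).length) :=
        Nat.mul_le_mul_left _ hcode
    _ ≤ N * (Fintype.card (Database F L K₁ K₂) * ((K₁ + K₂) * d)) +
        m * (K₁ * (K₂ * (Fintype.card (Database F L K₁ K₂) * d))) := by
        rw [mul_add]
        exact Nat.add_le_add_left hrest _
    _ = _ := by ring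

theorem rate_le [Nontrivial F] [NeZero N] [NeZero K₁] [NeZero K₂] {T₁ T₂ : ℕ}
    (hS : S.IsDBTPIR T₁ T₂) :
    S.rate ≤ ((N - (T₁ + T₂) : ℕ) : ℝ≥0∞) / N + ((K₁ : ℝ≥0∞)⁻¹ + (K₂ : ℝ≥0∞)⁻¹) := by
  unfold rate
  rcases eq_or_ne S.download ⊤ with h | h
  · simp [h]
  · obtain ⟨d, hd⟩ := ENat.ne_top_iff_exists.1 h
    have key := mul_le_download_mul hS d hd.ge
    rw [← hd]
    refine ENNReal.div_le_of_le_mul ?_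
    have hN : (N : ℝ≥0∞) ≠ 0 := by simp [NeZero.ne N]
    have hK₁ : (K₁ : ℝ≥0∞) ≠ 0 := by simp [NeZero.ne K₁]
    have hK₂ : (K₂ : ℝ≥0∞) ≠ 0 := by simp [NeZero.ne K₂]
    have hN' : (N : ℝ≥0∞) * (N : ℝ≥0∞)⁻¹ = 1 :=
      ENNReal.mul_inv_cancel hN (ENNReal.natCast_ne_top _)
    have hK₁' : (K₁ : ℝ≥0∞) * (K₁ : ℝ≥0∞)⁻¹ = 1 :=
      ENNReal.mul_inv_cancel hK₁ (ENNReal.natCast_ne_top _)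
    have hK₂' : (K₂ : ℝ≥0∞) * (K₂ : ℝ≥0∞)⁻¹ = 1 :=
      ENNReal.mul_inv_cancel hK₂ (ENNReal.natCast_ne_top _)
    have hne : (N * (K₁ * K₂) : ℝ≥0∞) ≠ 0 := mul_ne_zero hN (mul_ne_zero hK₁ hK₂)
    have hnt : (N * (K₁ * K₂) : ℝ≥0∞) ≠ ⊤ := by
      exact_mod_cast ENNReal.natCast_ne_top (N * (K₁ * K₂))
    rw [← ENNReal.mul_le_mul_iff_right hne hnt]
    generalize N - (T₁ + T₂) = m at key ⊢
    have key' : (N * (K₁ * (K₂ * L)) : ℝ≥0∞) ≤ d * (N * (K₁ + K₂) + m * (K₁ * K₂)) := by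
      exact_mod_cast key
    calc (N * (K₁ * K₂) : ℝ≥0∞) * L = N * (K₁ * (K₂ * L)) := by ring
      _ ≤ d * (N * (K₁ + K₂) + m * (K₁ * K₂)) := key'
      _ = d * (N * (K₁ * (K₂ * (K₂ : ℝ≥0∞)⁻¹) + K₂ * (K₁ * (K₁ : ℝ≥0∞)⁻¹)) +
          m * (K₁ * K₂) * (N * (N : ℝ≥0∞)⁻¹)) := by rw [hN', hK₁', hK₂']; ring
      _ = (N * (K₁ * K₂) : ℝ≥0∞) *
          ((m / N + ((K₁ : ℝ≥0∞)⁻¹ + (K₂ : ℝ≥0∞)⁻¹)) * d) := by rw [div_eq_mul_inv]; ring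

end Scheme

theorem IsLimitRate.le {F : Type} [Finite F] [Nontrivial F] {L N T₁ T₂ : ℕ} (hN : 0 < N)
    {r : ℝ≥0∞} (h : IsLimitRate F L N T₁ T₂ r) :
    r ≤ ((N - (T₁ + T₂) : ℕ) : ℝ≥0∞) / N := by
  have : NeZero N := ⟨hN.ne'⟩
  have hlim : Tendsto (fun K : ℕ × ℕ => ((N - (T₁ + T₂) : ℕ) : ℝ≥0∞) / N +
      ((K.1 : ℝ≥0∞)⁻¹ + (K.2 : ℝ≥0∞)⁻¹)) atTop (𝓝 (((N - (T₁ + T₂) : ℕ) : ℝ≥0∞) / N)) := by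
    have hinv := ENNReal.tendsto_inv_nat_nhds_zero
    rw [← prod_atTop_atTop_eq]
    simpa using tendsto_const_nhds.add
      ((hinv.comp tendsto_fst).add (hinv.comp tendsto_snd))
  refine le_of_tendsto_of_tendsto h hlim ?_
  filter_upwards [eventually_ge_atTop ((1, 1) : ℕ × ℕ)] with K hK
  have : NeZero K.1 := ⟨(Nat.lt_of_lt_of_le Nat.one_pos hK.1).ne'⟩
  have : NeZero K.2 := ⟨(Nat.lt_of_lt_of_le Nat.one_pos hK.2).ne'⟩
  exact iSup₂_le fun S hS => Scheme.rate_le hS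

/-! ### Achievability by cross-subspace alignment -/

section CrossSubspaceAlignment

open Polynomial

variable {F : Type} [Field F]

theorem eval_eq_sum_fin (p : F[X]) (T : ℕ) (hp : p.degree < T) (x : F) :
    p.eval x = ∑ t : Fin T, p.coeff t * x ^ (t : ℕ) := by
  rw [Fin.sum_univ_eq_sum_range fun t => p.coeff t * x ^ t]
  rcases eq_or_ne p 0 with rfl | h
  · simp
  · exact eval_eq_sum_range' ((natDegree_lt_iff_degree_lt h).2 hp) x

/-- Polynomials of degree at most `T` without constant term can take the value `1` at `T` nonzero
points. -/
theorem exists_coeff_sum_pow_succ_eq_one {ι : Type*} [DecidableEq ι] (𝒯 : Finset ι) (v : ι → F)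
    (hv : Set.InjOn v 𝒯) (hv0 : ∀ n ∈ 𝒯, v n ≠ 0) (T : ℕ) (hT : 𝒯.card ≤ T) :
    ∃ a : Fin T → F, ∀ n ∈ 𝒯, ∑ t : Fin T, v n ^ ((t : ℕ) + 1) * a t = 1 := by
  -- If `p` interpolates the inverses, then `X * p` has no constant term and takes the value `1` at
  -- every `v n`.
  set p := Lagrange.interpolate 𝒯 v fun n => (v n)⁻¹
  have hp : p.degree < T :=
    (Lagrange.degree_interpolate_lt _ hv).trans_le (by exact_mod_cast hT)
  refine ⟨fun t => p.coeff t, fun n hn => ?_⟩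
  have h : v n * p.eval (v n) = 1 := by
    rw [Lagrange.eval_interpolate_at_node _ hv hn, mul_inv_cancel₀ (hv0 n hn)]
  rw [eval_eq_sum_fin p T hp, Finset.mul_sum] at h
  rw [← h]
  exact Finset.sum_congr rfl fun t _ => by ring

theorem natDegree_C_sub_X_le (b : F) : (C b - X : F[X]).natDegree ≤ 1 :=
  (natDegree_sub_le _ _).trans (by simp)

theorem natDegree_const_add_sum_le (T : ℕ) (b e : F) (z : Fin T → F) :
    (C e + ∑ t : Fin T, (C b - X) ^ ((t : ℕ) + 1) * C (z t) : F[X]).natDegree ≤ T := by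
  refine natDegree_add_le_of_degree_le (by simp) (natDegree_sum_le_of_forall_le _ _ fun t _ => ?_)
  refine (natDegree_mul_C_le _ _).trans ((natDegree_pow_le_of_le _ (natDegree_C_sub_X_le b)).trans ?_)
  omega

/-- Alignment of the interference: only the value at `b` of the polynomial `G` is found along the
Cauchy term. -/
theorem exists_degree_lt_eval (G : F[X]) (T : ℕ) (hG : G.natDegree ≤ T) (b : F) :
    ∃ H : F[X], H.degree < T ∧
      ∀ a, a ≠ b → (b - a)⁻¹ * G.eval a = (b - a)⁻¹ * G.eval b + H.eval a := by
  set p := G - C (G.eval b)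
  -- Since `X - b` divides `G - G(b)`, the factor `(b - a)⁻¹` cancels and leaves minus the quotient,
  -- of degree one less.
  have hroot : p.IsRoot b := by simp [p]
  have hmul := mul_divByMonic_eq_iff_isRoot.2 hroot
  refine ⟨-(p /ₘ (X - C b)), ?_, fun a ha => ?_⟩
  · rw [degree_neg]
    rcases eq_or_ne p 0 with h | h
    · rw [h, zero_divByMonic, degree_zero]
      exact WithBot.bot_lt_coe T
    · refine (degree_divByMonic_lt p (X - C b) h (by simp)).trans_le
        (degree_le_of_natDegree_le ?_)
      exact (natDegree_sub_C (p := G)).le.trans hG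
  · have h := congrArg (eval a) hmul
    rw [eval_mul, eval_sub, eval_X, eval_C, eval_sub, eval_C] at h
    have hne : b - a ≠ 0 := sub_ne_zero.2 ha.symm
    have : G.eval a = G.eval b + (a - b) * (p /ₘ (X - C b)).eval a := by rw [h]; ring
    rw [this, eval_neg]
    field_simp
    ring

/-- The Cauchy-Vandermonde system is nonsingular. -/
theorem eq_zero_of_cauchy_vandermonde {N L T : ℕ} (hN : L + T ≤ N) (α : Fin N → F) (β : Fin L → F)
    (hα : Function.Injective α) (hβ : Function.Injective β) (hαβ : ∀ l n, β l ≠ α n)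
    (d : Fin L → F) (c : Fin T → F)
    (h : ∀ n, ∑ l, (β l - α n)⁻¹ * d l + ∑ t, c t * α n ^ (t : ℕ) = 0) : d = 0 := by
  funext l₀
  have hL := l₀.pos
  -- The system multiplied by all `β l - X`: a polynomial of degree below `L + T ≤ N` with `N`
  -- roots, hence zero. At `β l₀` only the term with `d l₀` survives.
  set P : F[X] := ∑ l, C (d l) * ∏ l' ∈ Finset.univ.erase l, (C (β l') - X) +
    ∑ t : Fin T, C (c t) * X ^ (t : ℕ) * ∏ l, (C (β l) - X) with hP
  have hprod : ∀ s : Finset (Fin L), (∏ l ∈ s, (C (β l) - X : F[X])).natDegree ≤ s.card := by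
    intro s
    refine (natDegree_prod_le _ _).trans ?_
    simpa using Finset.sum_le_card_nsmul s _ 1 fun l _ => natDegree_C_sub_X_le (β l)
  have hdeg : P.natDegree ≤ N - 1 := by
    refine natDegree_add_le_of_degree_le (natDegree_sum_le_of_forall_le _ _ fun l _ => ?_)
      (natDegree_sum_le_of_forall_le _ _ fun t _ => ?_)
    · refine (natDegree_C_mul_le _ _).trans ((hprod _).trans ?_)
      rw [Finset.card_erase_of_mem (Finset.mem_univ _), Finset.card_univ, Fintype.card_fin]
      omega
    · refine (natDegree_mul_le_of_le (natDegree_C_mul_X_pow_le _ _) (hprod _)).trans ?_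
      rw [Finset.card_univ, Fintype.card_fin]
      omega
  have hP0 : P = 0 := by
    refine eq_zero_of_natDegree_lt_card_of_eval_eq_zero P hα (fun n => ?_)
      (by rw [Fintype.card_fin]; omega)
    have h1 : P.eval (α n) = (∏ l, (β l - α n)) *
        (∑ l, (β l - α n)⁻¹ * d l + ∑ t, c t * α n ^ (t : ℕ)) := by
      rw [hP, eval_add, eval_finsetSum, eval_finsetSum, mul_add, Finset.mul_sum, Finset.mul_sum]
      congr 1
      · refine Finset.sum_congr rfl fun l _ => ?_
        rw [eval_mul, eval_C, eval_prod, ← Finset.mul_prod_erase Finset.univ _ (Finset.mem_univ l)]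
        have := sub_ne_zero.2 (hαβ l n)
        simp only [eval_sub, eval_C, eval_X]
        field_simp
      · refine Finset.sum_congr rfl fun t _ => ?_
        simp only [eval_mul, eval_C, eval_prod, eval_sub, eval_X, eval_pow]
        ring
    rw [h1, h, mul_zero]
  have h2 := congrArg (eval (β l₀)) hP0
  have hz : ∏ l, (β l - β l₀) = 0 := Finset.prod_eq_zero (Finset.mem_univ l₀) (sub_self _)
  simp only [hP, eval_add, eval_finsetSum, eval_mul, eval_C, eval_prod, eval_sub, eval_X, eval_pow,
    hz, mul_zero, Finset.sum_const_zero, add_zero, eval_zero] at h2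
  rw [Finset.sum_eq_single l₀] at h2
  · refine (mul_eq_zero.1 h2).resolve_right (Finset.prod_ne_zero_iff.2 fun l hl => ?_)
    exact sub_ne_zero.2 fun e => Finset.ne_of_mem_erase hl (hβ e)
  · intro l _ hl
    rw [Finset.prod_eq_zero (i := l₀) (Finset.mem_erase.2 ⟨hl.symm, Finset.mem_univ _⟩)
      (sub_self _), mul_zero]
  · simp

/-- The secret-shared query of a user with index `i` and randomness `z` to a server with evaluation
point `a`. -/
def csaQuery {L T K : ℕ} (β : Fin L → F) (i : Fin K) (z : Fin L → Fin T → Fin K → F) (a : F)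
    (l : Fin L) (k : Fin K) : F :=
  (if k = i then 1 else 0) + ∑ t : Fin T, (β l - a) ^ ((t : ℕ) + 1) * z l t k

/-- At `β l` the masks of both shares vanish, so the bilinear form takes the value `w i j l` there;
at `α n` everything else is aligned into one polynomial, with coefficients `c` independent of the
server. -/
theorem exists_csa_alignment {N L : ℕ} (α : Fin N → F) (β : Fin L → F)
    (hαβ : ∀ l n, β l ≠ α n) (T₁ T₂ : ℕ) {K₁ K₂ : ℕ} (w : Database F L K₁ K₂) (i : Fin K₁) (z : Fin L → Fin T₁ → Fin K₁ → F) (j : Fin K₂)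
    (y : Fin L → Fin T₂ → Fin K₂ → F) :
    ∃ c : Fin (T₁ + T₂) → F, ∀ n,
      ∑ l, (β l - α n)⁻¹ * ∑ k₁, ∑ k₂,
          csaQuery β i z (α n) l k₁ * w k₁ k₂ l * csaQuery β j y (α n) l k₂ =
        ∑ l, (β l - α n)⁻¹ * w i j l + ∑ t : Fin (T₁ + T₂), c t * α n ^ (t : ℕ) := by
  let G : Fin L → F[X] := fun l => ∑ k₁, ∑ k₂,
    (C (if k₁ = i then 1 else 0) + ∑ t : Fin T₁, (C (β l) - X) ^ ((t : ℕ) + 1) * C (z l t k₁)) *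
      C (w k₁ k₂ l) *
    (C (if k₂ = j then 1 else 0) + ∑ t : Fin T₂, (C (β l) - X) ^ ((t : ℕ) + 1) * C (y l t k₂))
  have hG : ∀ l, (G l).natDegree ≤ T₁ + T₂ := fun l =>
    natDegree_sum_le_of_forall_le _ _ fun k₁ _ => natDegree_sum_le_of_forall_le _ _ fun k₂ _ =>
      natDegree_mul_le_of_le
        ((natDegree_mul_C_le _ _).trans (natDegree_const_add_sum_le _ _ _ _))
        (natDegree_const_add_sum_le _ _ _ _)
  have heval : ∀ l a, (G l).eval a = ∑ k₁, ∑ k₂,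
      csaQuery β i z a l k₁ * w k₁ k₂ l * csaQuery β j y a l k₂ := by
    intro l a
    simp only [G, eval_finsetSum, eval_mul, eval_add, eval_C, eval_pow, eval_sub, eval_X, csaQuery]
  have hβ : ∀ l, (G l).eval (β l) = w i j l := by
    intro l
    rw [heval]
    simp [csaQuery]
  choose H hH hHG using fun l => exists_degree_lt_eval (G l) (T₁ + T₂) (hG l) (β l)
  refine ⟨fun t => ∑ l, (H l).coeff t, fun n => ?_⟩
  simp only [← heval, hHG _ _ (hαβ _ n).symm, hβ, Finset.sum_add_distrib, Finset.sum_mul]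
  congr 1
  rw [Finset.sum_comm]
  exact Finset.sum_congr rfl fun l _ => eval_eq_sum_fin _ _ (hH l) _

variable [Finite F]

/-- The uniform random source on a finite type. -/
def RandomSource.uniform (α : Type) [Finite α] [Nonempty α] : RandomSource :=
  letI : MeasurableSpace α := ⊤
  { Value := α
    law := uniformOn Set.univ }

theorem RandomSource.measurePreserving_uniform {α : Type} [Finite α] [Nonempty α] (e : α ≃ α) :
    MeasurePreserving (α := (RandomSource.uniform α).Value)
      (β := (RandomSource.uniform α).Value) e
      (RandomSource.uniform α).law (RandomSource.uniform α).law := by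
  let : MeasurableSpace α := ⊤
  exact measurePreserving_uniform_equiv e

namespace Scheme

/-- The cross-subspace alignment scheme with evaluation points `α` of the servers and `β` of the
message symbols. -/
def csa {N L : ℕ} (α : Fin N → F) (β : Fin L → F) (T₁ T₂ K₁ K₂ : ℕ) : Scheme F L N K₁ K₂ where
  user₁ := .uniform (Fin L → Fin T₁ → Fin K₁ → F)
  user₂ := .uniform (Fin L → Fin T₂ → Fin K₂ → F)
  server := .uniform (Fin (T₁ + T₂) → F)
  Query₁ := Fin L → Fin K₁ → F
  Query₂ := Fin L → Fin K₂ → F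
  query₁ i z n := csaQuery β i z (α n)
  query₂ j y n := csaQuery β j y (α n)
  answer n w q₁ q₂ s := [∑ l, (β l - α n)⁻¹ * ∑ k₁, ∑ k₂, q₁ l k₁ * w k₁ k₂ l * q₂ l k₂ +
    ∑ t : Fin (T₁ + T₂), s t * α n ^ (t : ℕ)]

variable {N L K : ℕ} (α : Fin N → F) (β : Fin L → F)

/-- The change of index is compensated at the servers of `𝒯` by a translation `c` of the uniform
mask, built from mask polynomials equal to `1` at their points. -/
theorem csaQuery_private (T : ℕ) (hα : Function.Injective α) (hαβ : ∀ l n, β l ≠ α n)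
    (𝒯 : Finset (Fin N)) (h𝒯 : 𝒯.card ≤ T) (i i' : Fin K) (q : 𝒯 → Fin L → Fin K → F) :
    (RandomSource.uniform (Fin L → Fin T → Fin K → F)).law
        {z | (fun n : 𝒯 => csaQuery β i z (α n)) = q} =
      (RandomSource.uniform (Fin L → Fin T → Fin K → F)).law
        {z | (fun n : 𝒯 => csaQuery β i' z (α n)) = q} := by
  choose a ha using fun l => exists_coeff_sum_pow_succ_eq_one 𝒯 (fun n => β l - α n)
    (fun n _ n' _ h => hα (sub_right_injective h)) (fun n _ => sub_ne_zero.2 (hαβ l n)) T h𝒯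
  let c : Fin L → Fin T → Fin K → F := fun l t k =>
    a l t * ((if k = i then 1 else 0) - if k = i' then 1 else 0)
  have mp := RandomSource.measurePreserving_uniform (Equiv.addRight c)
  rw [← mp.measure_preimage (s := {z | (fun n : 𝒯 => csaQuery β i' z (α n)) = q})
    MeasurableSet.of_discrete.nullMeasurableSet]
  congr 1
  refine Set.ext fun (z : Fin L → Fin T → Fin K → F) => ?_
  have h : ∀ n : 𝒯, csaQuery β i' (z + c) (α n) = csaQuery β i z (α n) := by
    intro n
    funext l k
    have h1 : ∑ t : Fin T, (β l - α n) ^ ((t : ℕ) + 1) * c l t k =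
        (if k = i then 1 else 0) - if k = i' then 1 else 0 := by
      calc _ = (∑ t : Fin T, (β l - α n) ^ ((t : ℕ) + 1) * a l t) *
            ((if k = i then 1 else 0) - if k = i' then 1 else 0) := by
            rw [Finset.sum_mul]
            exact Finset.sum_congr rfl fun t _ => (mul_assoc _ _ _).symm
        _ = _ := by rw [ha l n n.2, one_mul]
    simp only [csaQuery, Pi.add_apply, mul_add, Finset.sum_add_distrib, h1]
    ring
  change _ ↔ (fun n : 𝒯 => csaQuery β i' (z + c) (α n)) = q
  simp only [h]
  rfl

theorem isDBTPIR_csa (hα : Function.Injective α) (hβ : Function.Injective β)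
    (hαβ : ∀ l n, β l ≠ α n) (T₁ T₂ : ℕ) (hN : L + (T₁ + T₂) ≤ N) (K₁ K₂ : ℕ)
    [NeZero K₁] [NeZero K₂] : (csa α β T₁ T₂ K₁ K₂).IsDBTPIR T₁ T₂ := by
  set S := csa α β T₁ T₂ K₁ K₂ with hS
  -- The answers in the absence of interference: they involve only the desired message and the
  -- servers' mask.
  let base : Message F L → S.server.Value → Fin N → List F := fun m s n =>
    [∑ l, (β l - α n)⁻¹ * m l + ∑ t : Fin (T₁ + T₂), s t * α n ^ (t : ℕ)]
  have hbase : ∀ w i z j y, ∃ e : S.server.Value → S.server.Value,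
      MeasurePreserving e S.server.law S.server.law ∧
        ∀ s, S.answers w s i z j y = base (w i j) (e s) := by
    intro w i z j y
    obtain ⟨c, hc⟩ := exists_csa_alignment α β hαβ T₁ T₂ w i z j y
    -- The interference coefficients `c` merely translate the servers' uniform mask.
    refine ⟨_, RandomSource.measurePreserving_uniform (Equiv.addRight c), fun s => ?_⟩
    funext n
    refine congrArg (fun x => [x]) ?_
    refine (congrArg (· + ∑ t : Fin (T₁ + T₂), s t * α n ^ (t : ℕ)) (hc n)).trans ?_
    rw [add_assoc, ← Finset.sum_add_distrib]
    congr 1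
    refine Finset.sum_congr rfl fun t _ => ?_
    change c t * α n ^ (t : ℕ) + s t * α n ^ (t : ℕ) = (s t + c t) * α n ^ (t : ℕ)
    ring
  have hcorrect : ∀ ω ω' : S.Sample, S.A ω = S.A ω' → S.desired ω = S.desired ω' := by
    rintro ⟨w, s, ⟨i, z⟩, ⟨j, y⟩⟩ ⟨w', s', ⟨i', z'⟩, ⟨j', y'⟩⟩ h
    obtain ⟨e, -, he⟩ := hbase w i z j y
    obtain ⟨e', -, he'⟩ := hbase w' i' z' j' y'
    have h' : base (w i j) (e s) = base (w' i' j') (e' s') := (he s).symm.trans (h.trans (he' s'))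
    refine sub_eq_zero.1 (eq_zero_of_cauchy_vandermonde hN α β hα hβ hαβ (w i j - w' i' j')
      (fun t => e s t - e' s' t) fun n => ?_)
    have hn := List.head_eq_of_cons_eq (congrFun h' n)
    simp only [Pi.sub_apply, mul_sub, sub_mul, Finset.sum_sub_distrib]
    linear_combination hn
  refine ⟨?_, ?_, ?_, ?_, ?_, ?_, ?_⟩
  · intro n ω ω' _ _ h
    exact h.eq_of_length rfl
  · intro 𝒯 h𝒯
    rw [private₁_iff]
    exact csaQuery_private α β T₁ hα hαβ 𝒯 h𝒯
  · intro 𝒯 h𝒯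
    rw [private₂_iff]
    exact csaQuery_private α β T₂ hα hαβ 𝒯 h𝒯
  · rw [interUser₁_iff]
    intro i z _ j j' a m
    rw [S.prod_law_answers₁ base hbase, S.prod_law_answers₁ base hbase,
      Database.uniform_entry i i j j']
  · rw [interUser₂_iff]
    intro j y _ i i' a m
    rw [S.prod_law_answers₂ base hbase, S.prod_law_answers₂ base hbase,
      Database.uniform_entry i i' j j]
  · rw [condEntropy_eq_zero_iff]
    exact fun ω ω' _ _ h => hcorrect ω ω' (Prod.mk.inj h).1
  · rw [condEntropy_eq_zero_iff]
    exact fun ω ω' _ _ h => hcorrect ω ω' (Prod.mk.inj h).1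

theorem le_rate_csa (T₁ T₂ K₁ K₂ : ℕ) : (L : ℝ≥0∞) / N ≤ (csa α β T₁ T₂ K₁ K₂).rate := by
  have h : (csa α β T₁ T₂ K₁ K₂).download ≤ N := iSup₂_le fun ω _ => by
    have : ∑ n, ((csa α β T₁ T₂ K₁ K₂).A ω n).length = N := by
      simp [A, csa]
    rw [this]
  unfold rate
  gcongr
  exact_mod_cast h

end Scheme

theorem IsLimitRate.ge_of_csa {N L T₁ T₂ : ℕ} (hN : L + (T₁ + T₂) ≤ N)
    (hF : N + L ≤ Nat.card F) {r : ℝ≥0∞} (h : IsLimitRate F L N T₁ T₂ r) :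
    (L : ℝ≥0∞) / N ≤ r := by
  let := Fintype.ofFinite F
  -- The points `α` and `β` must be `N + L` distinct field elements.
  obtain ⟨e⟩ : Nonempty (Fin (N + L) ↪ F) :=
    Function.Embedding.nonempty_of_card_le (by
      rwa [Fintype.card_fin, ← Nat.card_eq_fintype_card])
  refine ge_of_tendsto h ?_
  filter_upwards [eventually_ge_atTop ((1, 1) : ℕ × ℕ)] with K hK
  have : NeZero K.1 := ⟨(Nat.lt_of_lt_of_le Nat.one_pos hK.1).ne'⟩
  have : NeZero K.2 := ⟨(Nat.lt_of_lt_of_le Nat.one_pos hK.2).ne'⟩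
  refine le_iSup₂_of_le (Scheme.csa (fun n => e (Fin.castAdd L n)) (fun l => e (Fin.natAdd N l))
    T₁ T₂ K.1 K.2) (Scheme.isDBTPIR_csa _ _ (e.injective.comp (Fin.castAdd_injective N L))
      (e.injective.comp (Fin.natAdd_injective L N)) (fun l n he => ?_) T₁ T₂ hN _ _)
    (Scheme.le_rate_csa _ _ _ _ _ _)
  have := congrArg Fin.val (e.injective he)
  simp only [Fin.val_natAdd, Fin.val_castAdd] at this
  omega

end CrossSubspaceAlignment

/-! ### The capacity formula -/

theorem ofReal_max_one_sub_div (N T : ℕ) (hN : 0 < N) :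
    ENNReal.ofReal (max (1 - (T : ℝ) / N) 0) = ((N - T : ℕ) : ℝ≥0∞) / N := by
  have hN' : (0 : ℝ) < N := by exact_mod_cast hN
  have h : max (1 - (T : ℝ) / N) 0 = ((N - T : ℕ) : ℝ) / N := by
    rcases le_total T N with h | h
    · rw [Nat.cast_sub h, sub_div, div_self hN'.ne', max_eq_left]
      rw [sub_nonneg, div_le_one hN']
      exact_mod_cast h
    · rw [Nat.sub_eq_zero_of_le h, Nat.cast_zero, zero_div, max_eq_right]
      rw [sub_nonpos, one_le_div hN']
      exact_mod_cast h
  rw [h, ENNReal.ofReal_div_of_pos hN', ENNReal.ofReal_natCast, ENNReal.ofReal_natCast]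

end DBTPIR

end

theorem theorem1 (N T₁ T₂ : ℕ) (hN : 0 < N) :
    (∀ (F : Type) [Field F] [Finite F] (L : ℕ), 0 < L →
      ∃ r : ENNReal, DBTPIR.IsLimitRate F L N T₁ T₂ r) ∧
    DBTPIR.asymptoticCapacity N T₁ T₂ =
      ENNReal.ofReal (max (1 - ((T₁ : ℝ) + (T₂ : ℝ)) / (N : ℝ)) 0) := by
  refine ⟨fun F _ _ L _ => DBTPIR.exists_isLimitRate F L N T₁ T₂, ?_⟩
  rw [← Nat.cast_add, DBTPIR.ofReal_max_one_sub_div N (T₁ + T₂) hN]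
  refine le_antisymm (sSup_le ?_) ?_
  · rintro r ⟨F, _, _, L, -, hr⟩
    exact hr.le hN
  · rcases Nat.eq_zero_or_pos (N - (T₁ + T₂)) with h | h
    · simp [h]
    · obtain ⟨p, hp, hprime⟩ := Nat.exists_infinite_primes (N + (N - (T₁ + T₂)))
      have : Fact p.Prime := ⟨hprime⟩
      obtain ⟨r, hr⟩ := DBTPIR.exists_isLimitRate (ZMod p) (N - (T₁ + T₂)) N T₁ T₂
      refine (hr.ge_of_csa (by omega) (by rwa [Nat.card_zmod])).trans (le_sSup ?_)
      exact ⟨ZMod p, inferInstance, inferInstance, _, h, hr⟩
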